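/- Let $SO(3)$ be the Lie group of real $3\times 3$ rotation matrices, with Lie algebra $\mathfrak{so}(3)$ (the skew-symmetric matrices), and let $\langle A,B\rangle_0=\tfrac12\operatorname{trace}(AB^{T})$ for $A,B\in\mathfrak{so}(3)$; this inner product is the value at the identity of a bi-invariant Riemannian metric on $SO(3)$. For a left-invariant Riemannian metric $g$ on $SO(3)$, let $\langle\cdot,\cdot\rangle_g$ be its value at the identity and let $\phi_g:\mathfrak{so}(3)\to\mathfrak{so}(3)$ be the endomorphism, self-adjoint and positive definite for $\langle\cdot,\cdot\rangle_0$, such that $\langle A,B\rangle_g=\langle\phi_g(A),B\rangle_0$ for all $A,B\in\mathfrak{so}(3)$. The eigenvalues of $g$ are the three eigenvalues of $\phi_g$, counted with multiplicity. Proposition. Let $g_1$ and $g_2$ be left-invariant Riemannian metrics on $SO(3)$. Then $(SO(3),g_1)$ and $(SO(3),g_2)$ are isometric (there is a diffeomorphism $f:SO(3)\to SO(3)$ with $f^*g_2=g_1$) if and only if $g_1$ and $g_2$ have the same eigenvalues, counted with multiplicity. -/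

import Mathlib

/-- The rotation group `SO(3)`, with the topology of a subspace of the real matrices. -/
abbrev SO3 : Type := Matrix.specialOrthogonalGroup (Fin 3) ℝ

namespace SO3

open scoped Manifold ContDiff Matrix

/-- The model space of the manifold `SO(3)`. -/
abbrev E3 : Type := EuclideanSpace ℝ (Fin 3)

/-- The skew-symmetric matrix of the linear map `w ↦ v × w`; this identifies `E3` with the
space `so(3)` of skew-symmetric matrices. -/
def hat (v : E3) : Matrix (Fin 3) (Fin 3) ℝ :=
  !![0, -v 2, v 1; v 2, 0, -v 0; -v 1, v 0, 0]

/-- The Cayley transform of `X = hat v`: this is `(1 + X / 2) * (1 - X / 2)⁻¹`, written out. -/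
noncomputable def cayleyMatrix (v : E3) : Matrix (Fin 3) (Fin 3) ℝ :=
  1 + (1 + (v 0 ^ 2 + v 1 ^ 2 + v 2 ^ 2) / 4)⁻¹ • (hat v + (1 / 2 : ℝ) • (hat v * hat v))

/-- The inverse of `cayleyMatrix`, defined on the rotations `M` with `1 + trace M ≠ 0` (the
rotations whose angle is not `π`). -/
noncomputable def cayleyCoord (M : Matrix (Fin 3) (Fin 3) ℝ) : E3 :=
  (2 * (1 + M.trace)⁻¹) • !₂[M 2 1 - M 1 2, M 0 2 - M 2 0, M 1 0 - M 0 1]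

theorem den_pos (v : E3) : 0 < 1 + (v 0 ^ 2 + v 1 ^ 2 + v 2 ^ 2) / 4 := by positivity

theorem mem_iff (M : Matrix (Fin 3) (Fin 3) ℝ) :
    M ∈ Matrix.specialOrthogonalGroup (Fin 3) ℝ ↔ Mᵀ * M = 1 ∧ M.det = 1 := by
  rw [Matrix.mem_specialOrthogonalGroup_iff, Matrix.mem_orthogonalGroup_iff']

theorem coe_inv (A : SO3) : ((A⁻¹ : SO3) : Matrix (Fin 3) (Fin 3) ℝ) = (A : Matrix (Fin 3) (Fin 3) ℝ)ᵀ := rfl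

theorem cayleyMatrix_mem (v : E3) :
    cayleyMatrix v ∈ Matrix.specialOrthogonalGroup (Fin 3) ℝ := by
  have h := (den_pos v).ne'
  rw [mem_iff]
  constructor
  · ext i j
    fin_cases i <;> fin_cases j <;>
      simp [cayleyMatrix, hat, Matrix.mul_apply, Fin.sum_univ_three] <;> field_simp <;> ring
  · simp [cayleyMatrix, hat, Matrix.det_fin_three]
    field_simp
    ring

theorem one_add_trace_cayleyMatrix (v : E3) :
    1 + (cayleyMatrix v).trace = 4 * (1 + (v 0 ^ 2 + v 1 ^ 2 + v 2 ^ 2) / 4)⁻¹ := by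
  have h := (den_pos v).ne'
  simp [cayleyMatrix, hat, Fin.sum_univ_three, Matrix.trace]
  field_simp
  ring

theorem cayleyCoord_cayleyMatrix (v : E3) : cayleyCoord (cayleyMatrix v) = v := by
  have h := (den_pos v).ne'
  ext i
  rw [cayleyCoord, one_add_trace_cayleyMatrix]
  fin_cases i <;>
  · simp [cayleyMatrix, hat]
    field_simp
    ring

theorem cayleyMatrix_cayleyCoord (A : SO3)
    (hA : 1 + (A : Matrix (Fin 3) (Fin 3) ℝ).trace ≠ 0) : cayleyMatrix (cayleyCoord A) = A := by
  obtain ⟨M, hM⟩ := A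
  simp only at hA ⊢
  obtain ⟨h1, h2⟩ := (mem_iff M).1 hM
  have h3 : M.adjugate = Mᵀ := by
    have := congrArg (· * M.adjugate) h1
    simpa [Matrix.mul_assoc, Matrix.mul_adjugate, h2] using this.symm
  have h4 : M * Mᵀ = 1 := mul_eq_one_comm.1 h1
  have e : ∀ i j, M.adjugate i j = M j i := fun i j => by rw [h3]; rfl
  have q : ∀ i j, (Mᵀ * M) i j = (1 : Matrix (Fin 3) (Fin 3) ℝ) i j := fun i j => by rw [h1]
  have r : ∀ i j, (M * Mᵀ) i j = (1 : Matrix (Fin 3) (Fin 3) ℝ) i j := fun i j => by rw [h4]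
  simp only [Matrix.adjugate_fin_three] at e
  simp [Fin.forall_fin_succ, Matrix.mul_apply, Fin.sum_univ_three] at e q r
  obtain ⟨⟨a1, a2, a3⟩, ⟨a4, a5, a6⟩, a7, a8, a9⟩ := e
  obtain ⟨⟨b1, b2, b3⟩, ⟨b4, b5, b6⟩, b7, b8, b9⟩ := q
  obtain ⟨⟨c1, c2, c3⟩, ⟨c4, c5, c6⟩, c7, c8, c9⟩ := r
  have ht : M.trace = M 0 0 + M 1 1 + M 2 2 := by simp [Matrix.trace, Fin.sum_univ_three]
  rw [ht] at hA
  obtain ⟨t, htt⟩ : ∃ t, t = 1 + (M 0 0 + M 1 1 + M 2 2) := ⟨_, rfl⟩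
  rw [← htt] at hA
  have hs : (1 + ((cayleyCoord M) 0 ^ 2 + (cayleyCoord M) 1 ^ 2 + (cayleyCoord M) 2 ^ 2) / 4)⁻¹
      = t / 4 := by
    have : (1 + ((cayleyCoord M) 0 ^ 2 + (cayleyCoord M) 1 ^ 2 + (cayleyCoord M) 2 ^ 2) / 4)
      = 4 / t := by
      simp [cayleyCoord, ht, ← htt]
      field_simp
      rw [htt]
      linear_combination 4 * (b1 + b5 + b9) + 8 * (a1 + a5 + a9)
    rw [this, inv_div]
  ext i j
  rw [cayleyMatrix, hs]
  fin_cases i <;> fin_cases j <;>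
      simp [cayleyCoord, hat, ht, ← htt] <;> field_simp <;> rw [htt]
  · linear_combination 2 * (a1 + a1 - b1 - c1 - 2 * (a1 + a5 + a9))
  · linear_combination 2 * (a2 + a4 - b2 - c2)
  · linear_combination 2 * (a3 + a7 - b3 - c3)
  · linear_combination 2 * (a4 + a2 - b4 - c4)
  · linear_combination 2 * (a5 + a5 - b5 - c5 - 2 * (a1 + a5 + a9))
  · linear_combination 2 * (a6 + a8 - b6 - c6)
  · linear_combination 2 * (a7 + a3 - b7 - c7)
  · linear_combination 2 * (a8 + a6 - b8 - c8)
  · linear_combination 2 * (a9 + a9 - b9 - c9 - 2 * (a1 + a5 + a9))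

/-- The Cayley transform as a map to `SO(3)`. -/
noncomputable def cayley (v : E3) : SO3 := ⟨cayleyMatrix v, cayleyMatrix_mem v⟩

/-- The inclusion of `SO(3)` in the space of `3 × 3` arrays of real numbers. -/
def entries (A : SO3) : Fin 3 → Fin 3 → ℝ := fun i j => (A : Matrix (Fin 3) (Fin 3) ℝ) i j

theorem continuous_entries : Continuous entries := continuous_subtype_val

theorem continuous_of_entries {X : Type*} [TopologicalSpace X] {f : X → SO3}
    (h : Continuous (fun x => entries (f x))) : Continuous f :=
  continuous_induced_rng.2 h

theorem contDiff_cayleyMatrix : ContDiff ℝ ω (fun (v : E3) i j => cayleyMatrix v i j) := by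
  have h : ∀ v : E3, 1 + (v 0 ^ 2 + v 1 ^ 2 + v 2 ^ 2) / 4 ≠ 0 := fun v => (den_pos v).ne'
  have hinv : ContDiff ℝ ω (fun v : E3 => (1 + (v 0 ^ 2 + v 1 ^ 2 + v 2 ^ 2) / 4)⁻¹) :=
    ContDiff.inv (by fun_prop) h
  refine contDiff_pi.2 fun i => contDiff_pi.2 fun j => ?_
  fin_cases i <;> fin_cases j <;>
    simp [cayleyMatrix, hat] <;> fun_prop

theorem continuous_cayley : Continuous cayley :=
  continuous_of_entries contDiff_cayleyMatrix.continuous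

theorem contDiffAt_cayleyCoord {N : Fin 3 → Fin 3 → ℝ} (h : 1 + (Matrix.of N).trace ≠ 0) :
    ContDiffAt ℝ ω (fun N : Fin 3 → Fin 3 → ℝ => cayleyCoord (Matrix.of N)) N := by
  have ht : ContDiff ℝ ω (fun N : Fin 3 → Fin 3 → ℝ => 1 + (Matrix.of N).trace) := by
    simp only [Matrix.trace, Matrix.diag, Fin.sum_univ_three, Matrix.of_apply]
    fun_prop
  have hi := ht.contDiffAt.inv h
  refine contDiffAt_piLp' 2 ?_
  intro i
  fin_cases i <;> simp only [cayleyCoord] <;>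
    exact (contDiffAt_const.mul hi).mul (by simp; fun_prop)

theorem contDiff_mul : ContDiff ℝ ω
    (fun (p : (Fin 3 → Fin 3 → ℝ) × (Fin 3 → Fin 3 → ℝ)) i j =>
      (Matrix.of p.1 * Matrix.of p.2) i j) := by
  refine contDiff_pi.2 fun i => contDiff_pi.2 fun j => ?_
  simp only [Matrix.mul_apply, Fin.sum_univ_three, Matrix.of_apply]
  fun_prop

theorem contDiff_mul_left (A : SO3) : ContDiff ℝ ω
    (fun (N : Fin 3 → Fin 3 → ℝ) i j => ((A : Matrix (Fin 3) (Fin 3) ℝ) * Matrix.of N) i j) :=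
  contDiff_mul.comp (contDiff_prodMk_right (entries A))

theorem continuous_mul_left (A : SO3) : Continuous (fun B : SO3 => A * B) :=
  continuous_of_entries ((contDiff_mul_left A).continuous.comp continuous_entries)

/-- The chart of `SO(3)` at `A`, whose inverse is `v ↦ A * cayley v`. -/
noncomputable def cayleyChart (A : SO3) : OpenPartialHomeomorph SO3 E3 where
  toFun B := cayleyCoord (A⁻¹ * B : SO3)
  invFun v := A * cayley v
  source := {B | 1 + ((A⁻¹ * B : SO3) : Matrix (Fin 3) (Fin 3) ℝ).trace ≠ 0}
  target := Set.univ
  map_source' _ _ := Set.mem_univ _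
  map_target' v _ := by
    have := den_pos v
    simp only [inv_mul_cancel_left, Set.mem_ofPred_eq, cayley, one_add_trace_cayleyMatrix]
    positivity
  left_inv' B hB := by
    have : cayley (cayleyCoord (A⁻¹ * B : SO3)) = A⁻¹ * B :=
      Subtype.ext (cayleyMatrix_cayleyCoord _ hB)
    rw [this, mul_inv_cancel_left]
  right_inv' v _ := by
    simp only [inv_mul_cancel_left, cayley, cayleyCoord_cayleyMatrix]
  open_source := by
    refine isOpen_ne_fun (continuous_const.add (Continuous.matrix_trace ?_)) continuous_const
    exact continuous_entries.comp (continuous_mul_left A⁻¹)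
  open_target := isOpen_univ
  continuousOn_toFun := by
    intro B hB
    exact (ContinuousAt.comp (g := fun N : Fin 3 → Fin 3 → ℝ => cayleyCoord (Matrix.of N))
      (f := fun B : SO3 => entries (A⁻¹ * B)) (contDiffAt_cayleyCoord hB).continuousAt
      (continuous_entries.comp (continuous_mul_left A⁻¹)).continuousAt).continuousWithinAt
  continuousOn_invFun := ((continuous_mul_left A).comp continuous_cayley).continuousOn

/-- The smooth structure of `SO(3)`. By `contMDiff_entries` and `contMDiff_of_entries` below it is
the one of a submanifold of the space of matrices. -/
noncomputable instance instChartedSpace : ChartedSpace E3 SO3 where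
  atlas := Set.range cayleyChart
  chartAt := cayleyChart
  mem_chart_source A := by
    change 1 + ((A⁻¹ * A : SO3) : Matrix (Fin 3) (Fin 3) ℝ).trace ≠ 0
    rw [inv_mul_cancel]
    simp [Matrix.trace_one]
    norm_num
  chart_mem_atlas A := ⟨A, rfl⟩

instance instIsManifold : IsManifold (𝓡 3) ω SO3 := by
  refine isManifold_of_contDiffOn _ _ _ ?_
  rintro _ _ ⟨A, rfl⟩ ⟨B, rfl⟩ v hv
  have hv' : 1 + ((B⁻¹ * (A * cayley v) : SO3) : Matrix (Fin 3) (Fin 3) ℝ).trace ≠ 0 :=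
    hv.1.2
  refine ContDiffAt.contDiffWithinAt ?_
  exact ContDiffAt.comp v (g := fun N : Fin 3 → Fin 3 → ℝ => cayleyCoord (Matrix.of N))
    (f := fun v => entries (B⁻¹ * (A * cayley v))) (contDiffAt_cayleyCoord hv')
    ((contDiff_mul_left B⁻¹).comp ((contDiff_mul_left A).comp contDiff_cayleyMatrix)).contDiffAt

/-- The inclusion in the space of matrices is smooth. -/
theorem contMDiff_entries : ContMDiff (𝓡 3) 𝓘(ℝ, Fin 3 → Fin 3 → ℝ) ω entries := by
  intro A
  rw [contMDiffAt_iff]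
  refine ⟨continuous_entries.continuousAt, ContDiffAt.contDiffWithinAt ?_⟩
  exact ((contDiff_mul_left A).comp contDiff_cayleyMatrix).contDiffAt

/-- A map to `SO(3)` is smooth if it is smooth as a map to the space of matrices. -/
theorem contMDiff_of_entries {E H N : Type*} [NormedAddCommGroup E] [NormedSpace ℝ E]
    [TopologicalSpace H] {I : ModelWithCorners ℝ E H} [TopologicalSpace N] [ChartedSpace H N]
    {f : N → SO3} {n : ℕ∞ω}
    (hf : ContMDiff I 𝓘(ℝ, Fin 3 → Fin 3 → ℝ) n (fun x => entries (f x))) :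
    ContMDiff I (𝓡 3) n f := by
  intro x
  have hc : Continuous f := continuous_of_entries hf.continuous
  rw [contMDiffAt_iff_target]
  refine ⟨hc.continuousAt, ?_⟩
  have h1 : 1 + (((f x)⁻¹ * f x : SO3) : Matrix (Fin 3) (Fin 3) ℝ).trace ≠ 0 :=
    mem_chart_source E3 (f x)
  have h2 := ((contDiffAt_cayleyCoord (N := entries ((f x)⁻¹ * f x)) h1).comp (entries (f x))
    (contDiff_mul_left (f x)⁻¹).contDiffAt).of_le (le_top : n ≤ ω)
  exact ContMDiffAt.comp (f := fun x => entries (f x)) x h2.contMDiffAt (hf x)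

/-- `SO(3)` is a Lie group. -/
instance instLieGroup : LieGroup (𝓡 3) ω SO3 where
  contMDiff_mul := by
    refine contMDiff_of_entries ?_
    exact contDiff_mul.contMDiff.comp ((contMDiff_entries.comp contMDiff_fst).prodMk_space
      (contMDiff_entries.comp contMDiff_snd))
  contMDiff_inv := by
    refine contMDiff_of_entries ?_
    have h : ContDiff ℝ ω (fun (p : Fin 3 → Fin 3 → ℝ) i j => p j i) := by fun_prop
    exact h.contMDiff.comp contMDiff_entries

/-- The derivative at the identity of the inclusion of `SO(3)` in the space of matrices: it
identifies the Lie algebra, the tangent space at the identity, with the skew-symmetric matrices. -/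
noncomputable def toMatrix :
    TangentSpace (𝓡 3) (1 : SO3) →ₗ[ℝ] Matrix (Fin 3) (Fin 3) ℝ :=
  (Matrix.ofLinearEquiv ℝ).toLinearMap ∘ₗ
    (mfderiv (𝓡 3) 𝓘(ℝ, Fin 3 → Fin 3 → ℝ) entries 1).toLinearMap

theorem hasDerivAt_cayleyMatrix (u : E3) (i j : Fin 3) :
    HasDerivAt (fun t : ℝ => cayleyMatrix (t • u) i j) (hat u i j) 0 := by
  have key : ∀ d q a b : ℝ,
      HasDerivAt (fun t : ℝ => d + (1 + t ^ 2 * q)⁻¹ * (t * a + t ^ 2 * b)) a 0 := by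
    intro d q a b
    have h1 : HasDerivAt (fun t : ℝ => 1 + t ^ 2 * q) 0 0 := by
      simpa using ((hasDerivAt_pow 2 (0 : ℝ)).mul_const q).const_add 1
    have h2 : HasDerivAt (fun t : ℝ => t * a + t ^ 2 * b) a 0 := by
      simpa using ((hasDerivAt_id (0 : ℝ)).mul_const a).fun_add
        ((hasDerivAt_pow 2 (0 : ℝ)).mul_const b)
    simpa using ((h1.fun_inv (by norm_num)).fun_mul h2).const_add d
  refine (key ((1 : Matrix (Fin 3) (Fin 3) ℝ) i j) ((u 0 ^ 2 + u 1 ^ 2 + u 2 ^ 2) / 4)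
    (hat u i j) (1 / 2 * (hat u * hat u) i j)).congr_of_eventuallyEq
    (Filter.Eventually.of_forall fun t => ?_)
  have hh : hat (t • u) = t • hat u := by
    ext i j
    fin_cases i <;> fin_cases j <;> simp [hat]
  simp only [cayleyMatrix, hh, Matrix.add_apply, Matrix.smul_apply, smul_eq_mul, PiLp.smul_apply,
    Matrix.smul_mul, Matrix.mul_smul]
  ring_nf

/-- In the chart at the identity, `toMatrix` is `hat`. -/
theorem toMatrix_apply (u : E3) : toMatrix u = hat u := by
  have h : HasFDerivAt (fun (v : E3) i j => cayleyMatrix v i j)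
      (mfderiv (𝓡 3) 𝓘(ℝ, Fin 3 → Fin 3 → ℝ) entries 1) 0 := by
    have h1 := (contMDiff_entries.mdifferentiableAt (by simp) (x := 1)).hasMFDerivAt.2
    have h2 : extChartAt (𝓡 3) (1 : SO3) 1 = (0 : E3) := by
      change cayleyCoord ((1⁻¹ * 1 : SO3) : Matrix (Fin 3) (Fin 3) ℝ) = 0
      rw [inv_mul_cancel]
      ext i
      fin_cases i <;> simp [cayleyCoord]
    rw [h2] at h1
    have h3 : writtenInExtChartAt (𝓡 3) 𝓘(ℝ, Fin 3 → Fin 3 → ℝ) (1 : SO3) entries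
        = fun (v : E3) i j => cayleyMatrix v i j := by
      funext v
      change entries (1 * cayley v) = _
      rw [one_mul]
      rfl
    rw [h3] at h1
    exact hasFDerivWithinAt_univ.1 (by simpa using h1)
  have h4 : HasDerivAt (fun t : ℝ => t • u) u 0 := by
    simpa using (hasDerivAt_id (0 : ℝ)).smul_const u
  have h5 := HasFDerivAt.comp_hasDerivAt_of_eq (0 : ℝ) h h4 (by simp)
  ext i j
  exact (hasDerivAt_pi.1 (hasDerivAt_pi.1 h5 i) j).unique (hasDerivAt_cayleyMatrix u i j)

instance (A : SO3) : FiniteDimensional ℝ (TangentSpace (𝓡 3) A) :=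
  inferInstanceAs (FiniteDimensional ℝ E3)

/-- The value at the identity of the bi-invariant metric `g₀` of `SO(3)`:
`⟨X, Y⟩₀ = (1 / 2) * trace (X * Yᵀ)` for skew-symmetric matrices `X`, `Y`. -/
noncomputable def biInvariantForm : LinearMap.BilinForm ℝ (TangentSpace (𝓡 3) (1 : SO3)) :=
  LinearMap.mk₂ ℝ (fun u v => (1 / 2) * (toMatrix u * (toMatrix v)ᵀ).trace)
    (by intros; simp [add_mul, mul_add]) (by intros; simp; ring)
    (by intros; simp [mul_add]) (by intros; simp; ring)

theorem biInvariantForm_apply (u v : TangentSpace (𝓡 3) (1 : SO3)) :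
    biInvariantForm u v = (1 / 2) * (toMatrix u * (toMatrix v)ᵀ).trace := rfl

theorem biInvariantForm_nondegenerate : biInvariantForm.Nondegenerate := by
  have key : ∀ u : E3, biInvariantForm u u = u 0 ^ 2 + u 1 ^ 2 + u 2 ^ 2 := by
    intro u
    have h : biInvariantForm u u = (1 / 2) * (hat u * (hat u)ᵀ).trace :=
      congrArg (fun M : Matrix (Fin 3) (Fin 3) ℝ => (1 / 2) * (M * Mᵀ).trace) (toMatrix_apply u)
    refine h.trans ?_
    simp only [Matrix.trace, Matrix.diag, Matrix.mul_apply, Matrix.transpose_apply,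
      Fin.sum_univ_three]
    simp [hat]
    ring
  have pos : ∀ u : E3, biInvariantForm u u = 0 → u = 0 := by
    intro u hu
    replace hu := (key u).symm.trans hu
    ext i
    fin_cases i <;> simp <;> nlinarith
  exact ⟨fun u hu => pos u (hu u), fun u hu => pos u (hu u)⟩

/-- Smooth Riemannian metrics on `SO(3)`. -/
abbrev SmoothMetric : Type :=
  Bundle.ContMDiffRiemannianMetric (𝓡 3) ∞ E3 (fun A : SO3 => TangentSpace (𝓡 3) A)

/-- The metric `g` is left-invariant: every left translation preserves it. -/
def IsLeftInvariant (g : SmoothMetric) : Prop :=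
  ∀ (A B : SO3) (u v : TangentSpace (𝓡 3) B),
    g.inner (A * B) (mfderiv (𝓡 3) (𝓡 3) (fun C : SO3 => A * C) B u)
      (mfderiv (𝓡 3) (𝓡 3) (fun C : SO3 => A * C) B v) = g.inner B u v

/-- `(SO(3), g₁)` and `(SO(3), g₂)` are isometric: there is a diffeomorphism `f` of `SO(3)` that
pulls `g₂` back to `g₁`. -/
def IsIsometric (g₁ g₂ : SmoothMetric) : Prop :=
  ∃ f : SO3 ≃ₘ^∞⟮𝓡 3, 𝓡 3⟯ SO3, ∀ (A : SO3) (u v : TangentSpace (𝓡 3) A),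
    g₂.inner (f A) (mfderiv (𝓡 3) (𝓡 3) f A u) (mfderiv (𝓡 3) (𝓡 3) f A v) = g₁.inner A u v

/-- The inner product of `g` on the tangent space at the identity. -/
noncomputable def formAtOne (g : SmoothMetric) :
    LinearMap.BilinForm ℝ (TangentSpace (𝓡 3) (1 : SO3)) :=
  LinearMap.mk₂ ℝ (fun u v => g.inner 1 u v) (by intros; simp) (by intros; simp)
    (by intros; simp) (by intros; simp)

/-- The endomorphism `φ` of the Lie algebra with `⟨u, v⟩ = ⟨φ u, v⟩₀`, where `⟨·, ·⟩` is the value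
of `g` at the identity; see `metricOperator_spec`. -/
noncomputable def metricOperator (g : SmoothMetric) :
    TangentSpace (𝓡 3) (1 : SO3) →ₗ[ℝ] TangentSpace (𝓡 3) (1 : SO3) :=
  (formAtOne g).symmCompOfNondegenerate biInvariantForm biInvariantForm_nondegenerate

theorem metricOperator_spec (g : SmoothMetric) (u v : TangentSpace (𝓡 3) (1 : SO3)) :
    g.inner 1 u v = biInvariantForm (metricOperator g u) v :=
  ((formAtOne g).symmCompOfNondegenerate_left_apply biInvariantForm_nondegenerate v u).symm

/-- The eigenvalues of the metric `g`, that is, of `φ`, with multiplicities. As `φ` is self-adjoint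
for `g₀`, there are three of them. -/
noncomputable def metricEigenvalues (g : SmoothMetric) : Multiset ℝ := (metricOperator g).charpoly.roots

end SO3

/-! If the eigenvalues agree, a rotation `C` conjugates one Gram matrix at the identity into the
other. Then `A ↦ C * A * C⁻¹` is an isometry, because the adjoint action of `C` on the Lie algebra,
read in `E3`, is `C` itself (`hat_mulVec`).

Conversely, an isometry `f` need not fix the identity or respect the group law, so the eigenvalues
are recovered from Riemannian invariants. A left-invariant orthonormal frame `X` has constant
brackets, recorded by a symmetric matrix `L`, and `M = (tr L / 2) • 1 - L` encodes the Levi-Civita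
connection. The map `f` carries the frame of the first metric to an orthogonal combination `Q` of
the frame of the second one, which has the matrix `M'`. Put `ε = det Q` and `K = Qᵀ * M' * Q`.
Uniqueness of the Levi-Civita connection says that `X i` applied to `Q` is `Q` times the
cross-product matrix of column `i` of `M - ε • K` (`IsFrameChange.map_eq_mul_skewMatrix`). Commuting
two such derivatives gives equality of the curvatures; as the Ricci tensor is twice the adjugate of
`M`, this reads `adj M = adj K` (`IsFrameChange.adjugate_eq`).

If `det M ≠ 0`, then `M = ± K`, and positive traces fix the sign. If `det M = 0`, the adjugate has
rank one and loses information; the covariant derivative of the curvature supplies the rest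
(`IsFrameChange.eval`, `diagonal_eq_of_adjugate_eq`). Finally `M` determines `L = (det P)⁻¹ • (P *
Pᵀ)`, hence `P * Pᵀ`, which has the spectrum of the Gram matrix `Pᵀ * P`.

The differential geometry takes place in the algebra of smooth functions on one Cayley chart, with
left-invariant fields as derivations. -/

open Matrix

/-! ### Cross products, skew-symmetric matrices and the curvature identity -/

section FrameAlgebra

variable {R : Type*} [CommRing R]

/-- The matrix of `w ↦ v × w`. -/
def skewMatrix (v : Fin 3 → R) : Matrix (Fin 3) (Fin 3) R :=
  !![0, -v 2, v 1; v 2, 0, -v 0; -v 1, v 0, 0]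

theorem skewMatrix_injective : Function.Injective (skewMatrix (R := R)) := by
  intro v w h
  have h0 := congrFun (congrFun h 2) 1
  have h1 := congrFun (congrFun h 0) 2
  have h2 := congrFun (congrFun h 1) 0
  simp [skewMatrix] at h0 h1 h2
  ext i
  fin_cases i <;> assumption

theorem skewMatrix_sub (v w : Fin 3 → R) : skewMatrix (v - w) = skewMatrix v - skewMatrix w := by
  ext i j
  fin_cases i <;> fin_cases j <;> simp [skewMatrix] <;> ring

theorem skewMatrix_add (v w : Fin 3 → R) : skewMatrix (v + w) = skewMatrix v + skewMatrix w := by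
  ext i j
  fin_cases i <;> fin_cases j <;> simp [skewMatrix] <;> ring

theorem skewMatrix_smul (a : R) (w : Fin 3 → R) : skewMatrix (a • w) = a • skewMatrix w := by
  ext i j
  fin_cases i <;> fin_cases j <;> simp [skewMatrix]

theorem skewMatrix_crossProduct (v w : Fin 3 → R) :
    skewMatrix (v ⨯₃ w) = skewMatrix v * skewMatrix w - skewMatrix w * skewMatrix v := by
  ext i j
  fin_cases i <;> fin_cases j <;>
    simp [skewMatrix, cross_apply] <;> ring

theorem skewMatrix_map {S : Type*} [CommRing S] (φ : R →+ S) (v : Fin 3 → R) :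
    (skewMatrix v).map φ = skewMatrix (fun k => φ (v k)) := by
  ext i j
  fin_cases i <;> fin_cases j <;> simp [skewMatrix]

/-- A matrix that is skew-symmetric is the matrix of a cross product. -/
theorem exists_skewMatrix_eq (h2 : IsUnit (2 : R)) {A : Matrix (Fin 3) (Fin 3) R}
    (hA : Aᵀ = -A) : A = skewMatrix ![A 2 1, A 0 2, A 1 0] := by
  have e : ∀ i j, A j i = -A i j := fun i j => congrFun (congrFun hA i) j
  have z : ∀ i, A i i = 0 := fun i => by
    refine h2.mul_left_cancel ?_
    linear_combination e i i
  ext i j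
  fin_cases i <;> fin_cases j <;> simp [skewMatrix, z] <;> exact e _ _

theorem adjugate_of_transpose_mul_self {Q : Matrix (Fin 3) (Fin 3) R} (hQ : Qᵀ * Q = 1) :
    Q.adjugate = Q.det • Qᵀ := by
  have := congrArg (· * Q.adjugate) hQ
  simpa [Matrix.mul_assoc, Matrix.mul_adjugate] using this.symm

theorem exists_eq_of_transpose_eq {S : Type*} {A : Matrix (Fin 3) (Fin 3) S} (hA : Aᵀ = A) :
    ∃ a b c d e f, A = !![a, b, c; b, d, e; c, e, f] := by
  have s : ∀ i j, A j i = A i j := fun i j => congrFun (congrFun hA i) j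
  refine ⟨A 0 0, A 0 1, A 0 2, A 1 1, A 1 2, A 2 2, ?_⟩
  ext i j
  fin_cases i <;> fin_cases j <;> simp <;> exact s _ _

/-- The hypothesis `h` is the integrability condition for `Q`, with the derivatives of `B` already
substituted and `M = B + ε • K`. Modulo `ε * ε = 1`, its entries used here say that `2 • Δ - tr Δ •
1 = 0` for `Δ = adj M - adj K`, which is the equality of the curvature operators. Adding two
diagonal entries isolates twice the third one of `Δ`. -/
theorem adjugate_add_smul_of_curvature (h2 : IsUnit (2 : R)) {ε : R} (hε : ε * ε = 1)
    {B K : Matrix (Fin 3) (Fin 3) R} (hB : Bᵀ = B) (hK : Kᵀ = K)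
    (h : ∀ c k, (Bᵀ (c + 1) ⨯₃ Bᵀ (c + 2)) k +
      (-(ε * ((K * skewMatrix (Bᵀ (c + 1))) k (c + 2) - (skewMatrix (Bᵀ (c + 1)) * K) k (c + 2)))
        - -(ε * ((K * skewMatrix (Bᵀ (c + 2))) k (c + 1)
          - (skewMatrix (Bᵀ (c + 2)) * K) k (c + 1))))
      = (B * ((B + ε • K).trace • 1 - (B + ε • K))) k c) :
    (B + ε • K).adjugate = K.adjugate := by
  obtain ⟨a, b, c, d, e, f, rfl⟩ := exists_eq_of_transpose_eq hB
  obtain ⟨a', b', c', d', e', f', rfl⟩ := exists_eq_of_transpose_eq hK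
  have h00 := h 0 0
  have h01 := h 1 0
  have h02 := h 2 0
  have h11 := h 1 1
  have h12 := h 2 1
  have h22 := h 2 2
  clear h
  simp [Matrix.mul_apply, Fin.sum_univ_three, skewMatrix, Matrix.trace, cross_apply]
    at h00 h01 h02 h11 h12 h22
  simp only [adjugate_fin_three]
  ext i j
  refine h2.mul_left_cancel ?_
  fin_cases i <;> fin_cases j <;> simp
  · linear_combination -h11 - h22 + 2 * (d' * f' - e' * e') * hε
  · linear_combination h01 + 2 * (c' * e' - b' * f') * hε
  · linear_combination h02 + 2 * (b' * e' - c' * d') * hε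
  · linear_combination h01 + 2 * (c' * e' - b' * f') * hε
  · linear_combination -h00 - h22 + 2 * (a' * f' - c' * c') * hε
  · linear_combination h12 + 2 * (b' * c' - a' * e') * hε
  · linear_combination h02 + 2 * (b' * e' - c' * d') * hε
  · linear_combination h12 + 2 * (b' * c' - a' * e') * hε
  · linear_combination -h00 - h11 + 2 * (a' * d' - b' * b') * hε

/-! ### Derivations acting on matrices, and frame changes -/

variable [Algebra ℝ R]

theorem isUnit_two_of_algebra : IsUnit (2 : R) := by
  have := (IsUnit.mk0 (2 : ℝ) two_ne_zero).map (algebraMap ℝ R)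
  rwa [map_ofNat] at this

theorem Derivation.map_matrix_mul (D : Derivation ℝ R R) (A B : Matrix (Fin 3) (Fin 3) R) :
    (A * B).map D = A.map D * B + A * B.map D := by
  ext i j
  simp [Matrix.mul_apply, Fin.sum_univ_three, Derivation.leibniz]
  ring

theorem Derivation.map_matrix_sub (D : Derivation ℝ R R) (A B : Matrix (Fin 3) (Fin 3) R) :
    (A - B).map D = A.map D - B.map D := by
  ext i j
  simp

theorem Derivation.map_matrix_smul (D : Derivation ℝ R R) (a : R)
    (B : Matrix (Fin 3) (Fin 3) R) : (a • B).map D = D a • B + a • B.map D := by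
  ext i j
  simp [Derivation.leibniz]
  ring

theorem Derivation.map_matrix_one (D : Derivation ℝ R R) :
    (1 : Matrix (Fin 3) (Fin 3) R).map D = 0 := by
  ext i j
  by_cases h : i = j
  · subst h; simp
  · simp [h]

theorem Derivation.map_matrix_transpose (D : Derivation ℝ R R) (A : Matrix (Fin 3) (Fin 3) R) :
    Aᵀ.map D = (A.map D)ᵀ := rfl

theorem Derivation.map_matrix_algebraMap (D : Derivation ℝ R R) (A : Matrix (Fin 3) (Fin 3) ℝ) :
    (A.map (algebraMap ℝ R)).map D = 0 := by
  ext i j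
  simp

/-- The determinant squares to one. Since `R` need not be a domain, it cannot be replaced by `1` or
`-1`, but it is constant for every derivation. -/
theorem Derivation.map_det_eq_zero {Q : Matrix (Fin 3) (Fin 3) R} (hQ : Qᵀ * Q = 1)
    (D : Derivation ℝ R R) : D Q.det = 0 := by
  have h : Q.det * Q.det = 1 := by
    have := congrArg Matrix.det hQ
    simpa [Matrix.det_mul] using this
  have h' := congrArg D h
  simp only [Derivation.leibniz, smul_eq_mul, Derivation.map_one_eq_zero] at h'
  refine (isUnit_two_of_algebra (R := R)).mul_left_cancel ?_
  linear_combination Q.det * h' - 2 * D Q.det * h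

/-- The system of equations satisfied by an orthogonal change of frame `Q` between two frames of
vector fields whose brackets are given by `L` and `L'`. The frame `X` has brackets
`[X (c + 1), X (c + 2)] = ∑ k, L k c • X k`. -/
structure IsFrameChange (X : Fin 3 → Derivation ℝ R R) (L L' Q : Matrix (Fin 3) (Fin 3) R) :
    Prop where
  bracket : ∀ c r, X (c + 1) (X (c + 2) r) - X (c + 2) (X (c + 1) r) = ∑ k, L k c * X k r
  orthogonal : Qᵀ * Q = 1
  torsion : ∀ k c, X (c + 1) (Q k (c + 2)) - X (c + 2) (Q k (c + 1)) + (L' * Q.adjugateᵀ) k c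
    = (Q * L) k c

/-! ### Uniqueness of the Levi-Civita connection and equality of curvatures -/

namespace IsFrameChange

variable {X : Fin 3 → Derivation ℝ R R} {M M' Q : Matrix (Fin 3) (Fin 3) R}

/-- The difference of the two Levi-Civita connections, in the frame `X`. -/
theorem map_eq_mul_skewMatrix
    (h : IsFrameChange X (M.trace • 1 - M) (M'.trace • 1 - M') Q) (hM : Mᵀ = M) (hM' : M'ᵀ = M')
    (i : Fin 3) :
    Q.map (X i) = Q * skewMatrix ((M - Q.det • (Qᵀ * M' * Q))ᵀ i) := by
  have hQ := h.orthogonal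
  have hQ' : Q * Qᵀ = 1 := mul_eq_one_comm.1 hQ
  have hs : ∀ i, (Qᵀ * Q.map (X i))ᵀ = -(Qᵀ * Q.map (X i)) := fun i => by
    have := Derivation.map_matrix_mul (X i) Qᵀ Q
    rw [hQ, Derivation.map_matrix_one, Derivation.map_matrix_transpose] at this
    rw [transpose_mul, transpose_transpose, eq_neg_iff_add_eq_zero, ← this]
  obtain ⟨b, hb⟩ : ∃ b : Fin 3 → Fin 3 → R, ∀ i, Qᵀ * Q.map (X i) = skewMatrix (b i) :=
    ⟨_, fun i => exists_skewMatrix_eq isUnit_two_of_algebra (hs i)⟩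
  have hb' : ∀ i, Q.map (X i) = Q * skewMatrix (b i) := fun i => by
    rw [← hb, ← Matrix.mul_assoc, hQ', Matrix.one_mul]
  set B : Matrix (Fin 3) (Fin 3) R := (Matrix.of b)ᵀ with hB
  -- The antisymmetrized derivatives see `B` only through `tr B • 1 - Bᵀ`. This map is injective
  -- because 2 is invertible, so the torsion equation determines the connection.
  have hY : Matrix.of (fun k c => X (c + 1) (Q k (c + 2)) - X (c + 2) (Q k (c + 1)))
      = Q * (B.trace • 1 - Bᵀ) := by
    ext k c
    have e : ∀ i j, X i (Q k j) = (Q * skewMatrix (b i)) k j := fun i j => by rw [← hb']; rfl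
    simp only [Matrix.of_apply, e]
    fin_cases c <;> simp [Matrix.mul_apply, Fin.sum_univ_three, skewMatrix, B, Matrix.trace] <;>
      ring
  have hT : Q * (B.trace • 1 - Bᵀ) + (M'.trace • 1 - M') * Q.adjugateᵀ
      = Q * (M.trace • 1 - M) := by
    rw [← hY]
    ext k c
    exact h.torsion k c
  rw [adjugate_of_transpose_mul_self hQ] at hT
  have hT' := congrArg (Qᵀ * ·) hT
  simp only [Matrix.mul_add, ← Matrix.mul_assoc, hQ, Matrix.one_mul, transpose_smul,
    transpose_transpose, Matrix.mul_smul, Matrix.mul_sub, Matrix.sub_mul, Matrix.mul_one,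
    Matrix.smul_mul] at hT'
  obtain ⟨K, hK⟩ : ∃ K, K = Qᵀ * M' * Q := ⟨_, rfl⟩
  have hKt : K.trace = M'.trace := by
    rw [hK, Matrix.trace_mul_comm, ← Matrix.mul_assoc, hQ', Matrix.one_mul]
  have hKs : Kᵀ = K := by simp [hK, hM', Matrix.mul_assoc]
  rw [← hK, ← hKt] at hT'
  have hBt : B.trace = M.trace - Q.det * K.trace := by
    have := congrArg Matrix.trace hT'
    simp only [trace_add, trace_sub, trace_smul, trace_transpose, trace_one, Fintype.card_fin,
      smul_eq_mul] at this
    refine (isUnit_two_of_algebra (R := R)).mul_left_cancel ?_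
    push_cast at this
    linear_combination this
  rw [hBt] at hT'
  have hBe : Bᵀ = M - Q.det • K := by
    rw [← sub_eq_zero] at hT' ⊢
    rw [← neg_eq_zero, ← hT']
    module
  have hbi : (M - Q.det • (Qᵀ * M' * Q))ᵀ i = b i := by
    rw [← hK, transpose_sub, transpose_smul, hKs, hM, ← hBe]
    rfl
  rw [hbi, hb']

/-- Differentiating both factors `Q` gives a commutator, as the logarithmic derivative of `Q` is
skew-symmetric. With `A = M'` this yields the derivative of `K`; with `A = adj M'` it yields that of
the curvature. -/
theorem map_conj (h : IsFrameChange X (M.trace • 1 - M) (M'.trace • 1 - M') Q)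
    (hM : Mᵀ = M) (hM' : M'ᵀ = M') {A : Matrix (Fin 3) (Fin 3) R} (i : Fin 3)
    (hA : A.map (X i) = 0) :
    (Qᵀ * A * Q).map (X i) =
      Qᵀ * A * Q * skewMatrix ((M - Q.det • (Qᵀ * M' * Q))ᵀ i) -
        skewMatrix ((M - Q.det • (Qᵀ * M' * Q))ᵀ i) * (Qᵀ * A * Q) := by
  have ht : ∀ v : Fin 3 → R, (skewMatrix v)ᵀ = -skewMatrix v := fun v => by
    ext i j
    fin_cases i <;> fin_cases j <;> simp [skewMatrix]
  rw [Derivation.map_matrix_mul, Derivation.map_matrix_mul, hA, Derivation.map_matrix_transpose,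
    h.map_eq_mul_skewMatrix hM hM', transpose_mul, ht]
  noncomm_ring

/-- The equality of the curvatures. -/
theorem adjugate_eq (h : IsFrameChange X (M.trace • 1 - M) (M'.trace • 1 - M') Q)
    (hM : Mᵀ = M) (hM' : M'ᵀ = M') (hc : ∀ i, M.map (X i) = 0) (hc' : ∀ i, M'.map (X i) = 0) :
    M.adjugate = (Qᵀ * M' * Q).adjugate := by
  have hQ := h.orthogonal
  have hQ' : Q * Qᵀ = 1 := mul_eq_one_comm.1 hQ
  have hd : Q.det * Q.det = 1 := by
    have := congrArg Matrix.det hQ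
    simpa [Matrix.det_mul] using this
  have hK := fun i => h.map_conj hM hM' i (hc' i)
  have hQi := h.map_eq_mul_skewMatrix hM hM'
  have hKs : (Qᵀ * M' * Q)ᵀ = Qᵀ * M' * Q := by simp [hM', Matrix.mul_assoc]
  have hε := fun i => Derivation.map_det_eq_zero hQ (X i)
  generalize Qᵀ * M' * Q = K at *
  generalize Q.det = ε at *
  obtain ⟨B, hB⟩ : ∃ B, B = M - ε • K := ⟨_, rfl⟩
  have hBs : Bᵀ = B := by rw [hB, transpose_sub, transpose_smul, hM, hKs]
  have hBm : ∀ i, B.map (X i) = -(ε • (K * skewMatrix (Bᵀ i) - skewMatrix (Bᵀ i) * K)) := by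
    intro i
    rw [hB, Derivation.map_matrix_sub, Derivation.map_matrix_smul, hc, hε, hK, ← hB]
    simp
  rw [← hB] at hQi
  have hQQ : ∀ i j, (Q.map (X j)).map (X i) = Q * (skewMatrix (Bᵀ i) * skewMatrix (Bᵀ j)
      + skewMatrix (fun k => X i (B k j))) := by
    intro i j
    rw [hQi j, Derivation.map_matrix_mul, hQi i, Matrix.mul_add, Matrix.mul_assoc]
    congr 2
    exact skewMatrix_map (X i : R →+ R) _
  -- The commutator of `X (c + 1)` and `X (c + 2)` on `Q` is computed twice: from the second
  -- derivatives, and from the bracket relations.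
  have hcomm : ∀ c, Bᵀ (c + 1) ⨯₃ Bᵀ (c + 2) +
      ((fun k => X (c + 1) (B k (c + 2))) - fun k => X (c + 2) (B k (c + 1)))
      = (B * (M.trace • 1 - M))ᵀ c := by
    intro c
    apply skewMatrix_injective
    have e : (Q.map (X (c + 2))).map (X (c + 1)) - (Q.map (X (c + 1))).map (X (c + 2))
        = Q * skewMatrix ((B * (M.trace • 1 - M))ᵀ c) := by
      have : skewMatrix ((B * (M.trace • 1 - M))ᵀ c)
          = ∑ k, (M.trace • (1 : Matrix (Fin 3) (Fin 3) R) - M) k c • skewMatrix (Bᵀ k) := by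
        simp only [Fin.sum_univ_three, ← skewMatrix_smul, ← skewMatrix_add]
        congr 1
        ext k
        simp only [transpose_apply, Matrix.mul_apply, Fin.sum_univ_three, Pi.add_apply,
          Pi.smul_apply, smul_eq_mul]
        ring
      rw [this, Matrix.mul_sum]
      simp only [Matrix.mul_smul, ← hQi]
      ext k l
      have := h.bracket c (Q k l)
      simpa [Matrix.sum_apply] using this
    rw [hQQ, hQQ, ← Matrix.mul_sub] at e
    have e' := congrArg (Qᵀ * ·) e
    simp only [← Matrix.mul_assoc, hQ, Matrix.one_mul] at e'
    rw [skewMatrix_add, skewMatrix_crossProduct, skewMatrix_sub, ← e']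
    abel
  have hM1 : M = B + ε • K := by rw [hB]; abel
  have hXB : ∀ i j k, X i (B k j) = -(ε * ((K * skewMatrix (Bᵀ i)) k j
      - (skewMatrix (Bᵀ i) * K) k j)) := fun i j k => by
    have := congrFun (congrFun (hBm i) k) j
    simpa using this
  have hE : ∀ c k, (Bᵀ (c + 1) ⨯₃ Bᵀ (c + 2)) k +
      (X (c + 1) (B k (c + 2)) - X (c + 2) (B k (c + 1)))
      = (B * (M.trace • 1 - M)) k c := fun c k => congrFun (hcomm c) k
  simp only [hXB] at hE
  rw [hM1] at hE ⊢
  exact adjugate_add_smul_of_curvature isUnit_two_of_algebra hd hBs hKs hE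

end IsFrameChange

end FrameAlgebra

/-! ### Curvature and its covariant derivative at a point -/

section FrameChangeAtPoint

variable {R : Type*} [CommRing R] [Algebra ℝ R]

/-- The last part is naturality of the covariant derivative of the curvature: in `adj M = Qᵀ * adj
M' * Q` the left side is constant, so the commutator obtained by differentiating the right side
vanishes. -/
theorem IsFrameChange.eval {X : Fin 3 → Derivation ℝ R R} {M M' : Matrix (Fin 3) (Fin 3) ℝ}
    {Q : Matrix (Fin 3) (Fin 3) R}
    (h : IsFrameChange X ((M.trace • 1 - M).map (algebraMap ℝ R))
      ((M'.trace • 1 - M').map (algebraMap ℝ R)) Q) (hM : Mᵀ = M) (hM' : M'ᵀ = M')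
    (φ : R →ₐ[ℝ] ℝ) :
    (Q.map φ)ᵀ * Q.map φ = 1 ∧ M.adjugate = ((Q.map φ)ᵀ * M' * Q.map φ).adjugate ∧
    ∀ i, M.adjugate * skewMatrix ((M - (Q.map φ).det • ((Q.map φ)ᵀ * M' * Q.map φ))ᵀ i)
      = skewMatrix ((M - (Q.map φ).det • ((Q.map φ)ᵀ * M' * Q.map φ))ᵀ i) * M.adjugate := by
  have hL : ∀ N : Matrix (Fin 3) (Fin 3) ℝ, (N.trace • 1 - N).map (algebraMap ℝ R)
      = (N.map (algebraMap ℝ R)).trace • 1 - N.map (algebraMap ℝ R) := fun N => by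
    ext i j
    by_cases hij : i = j <;> simp [hij, Matrix.trace]
  rw [hL, hL] at h
  have hMs : (M.map (algebraMap ℝ R))ᵀ = M.map (algebraMap ℝ R) := by
    rw [← Matrix.transpose_map, hM]
  have hMs' : (M'.map (algebraMap ℝ R))ᵀ = M'.map (algebraMap ℝ R) := by
    rw [← Matrix.transpose_map, hM']
  have hQ := h.orthogonal
  have hQ' : Q * Qᵀ = 1 := mul_eq_one_comm.1 hQ
  have hd : Q.det * Q.det = 1 := by
    have := congrArg Matrix.det hQ
    simpa [Matrix.det_mul] using this
  have ha := h.adjugate_eq hMs hMs' (fun i => Derivation.map_matrix_algebraMap _ _)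
    (fun i => Derivation.map_matrix_algebraMap _ _)
  -- The adjugate of `Q` is `det Q • Qᵀ`, and the two determinant factors multiply to one.
  have ha2 : (Qᵀ * M'.map (algebraMap ℝ R) * Q).adjugate
      = Qᵀ * M'.adjugate.map (algebraMap ℝ R) * Q := by
    have e : (M'.map (algebraMap ℝ R)).adjugate = M'.adjugate.map (algebraMap ℝ R) :=
      ((algebraMap ℝ R).map_adjugate M').symm
    rw [adjugate_mul_distrib, adjugate_mul_distrib, e, ← adjugate_transpose,
      adjugate_of_transpose_mul_self hQ]
    simp [Matrix.mul_assoc, smul_smul, hd]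
  have hcomm := fun i => h.map_conj hMs hMs' i
    (Derivation.map_matrix_algebraMap (X i) M'.adjugate)
  have e : (M.map (algebraMap ℝ R)).adjugate = M.adjugate.map (algebraMap ℝ R) :=
    ((algebraMap ℝ R).map_adjugate M).symm
  rw [← ha2, ← ha, e] at hcomm
  simp only [Derivation.map_matrix_algebraMap] at hcomm
  have hm : ∀ A B : Matrix (Fin 3) (Fin 3) R, (A * B).map φ = A.map φ * B.map φ :=
    fun A B => Matrix.map_mul
  have hc : ∀ A : Matrix (Fin 3) (Fin 3) ℝ, (A.map (algebraMap ℝ R)).map φ = A := fun A => by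
    ext i j
    simp
  have hdet : (Q.map φ).det = φ Q.det := ((φ : R →+* ℝ).map_det Q).symm
  have hK : (Qᵀ * M'.map (algebraMap ℝ R) * Q).map φ = (Q.map φ)ᵀ * M' * Q.map φ := by
    rw [hm, hm, hc, ← Matrix.transpose_map]
  refine ⟨?_, ?_, fun i => ?_⟩
  · rw [← Matrix.transpose_map, ← hm, hQ]
    exact Matrix.map_one _ (map_zero _) (map_one _)
  · rw [← hK]
    have := congrArg (fun A : Matrix (Fin 3) (Fin 3) R => A.map φ) ha
    simp only [e, hc] at this
    rw [this]
    exact (φ : R →+* ℝ).map_adjugate _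
  · have hs : (skewMatrix ((M.map (algebraMap ℝ R) -
        Q.det • (Qᵀ * M'.map (algebraMap ℝ R) * Q))ᵀ i)).map φ
        = skewMatrix ((M - (Q.map φ).det • ((Q.map φ)ᵀ * M' * Q.map φ))ᵀ i) := by
      refine (skewMatrix_map (φ : R →+ ℝ) _).trans ?_
      congr 1
      ext k
      have hki : φ ((Qᵀ * M'.map (algebraMap ℝ R) * Q) k i)
          = ((Q.map φ)ᵀ * M' * Q.map φ) k i := congrFun (congrFun hK k) i
      rw [hdet]
      simp only [AddMonoidHom.coe_coe, transpose_apply, Matrix.sub_apply, Matrix.smul_apply,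
        map_apply, map_sub, smul_eq_mul, map_mul, AlgHom.commutes, Algebra.algebraMap_self,
        RingHom.id_apply, hki]
    have := congrArg (fun A : Matrix (Fin 3) (Fin 3) R => A.map φ) (sub_eq_zero.1 (hcomm i).symm)
    simp only [hm, hs, hc] at this
    exact this

end FrameChangeAtPoint

/-! ### Recovering the connection matrix from its adjugate -/

/-- In dimension three the adjugate has determinant `det ^ 2`, so the two determinants agree up to
sign. The adjugate then recovers the matrix up to the same sign, and positive traces exclude the
minus sign. -/
theorem eq_of_adjugate_eq_of_det_ne_zero {n : Type*} [Fintype n] [DecidableEq n]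
    {M K : Matrix n n ℝ} (hcard : Fintype.card n = 3) (hMt : 0 < M.trace) (hKt : 0 < K.trace)
    (h : M.adjugate = K.adjugate) (hd : M.det ≠ 0) : M = K := by
  have h1 : M * M.adjugate = M.det • 1 := M.mul_adjugate
  have h2 : K * M.adjugate = K.det • 1 := h ▸ K.mul_adjugate
  have h3 : M.adjugate.det = M.det ^ 2 := by rw [det_adjugate, hcard]
  have h4 : M.adjugate.det = K.det ^ 2 := by rw [h, det_adjugate, hcard]
  have h5 : K.det • M = M.det • K := by
    have e : (K.det • M - M.det • K) * M.adjugate = 0 := by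
      rw [Matrix.sub_mul, Matrix.smul_mul, Matrix.smul_mul, h1, h2, smul_smul, smul_smul, mul_comm,
        sub_self]
    have e' := congrArg (· * M.adjugate.adjugate) e
    simp only [Matrix.mul_assoc, mul_adjugate, Matrix.zero_mul, h3, Matrix.mul_smul,
      Matrix.mul_one] at e'
    exact sub_eq_zero.1 ((smul_eq_zero.1 e').resolve_left (pow_ne_zero 2 hd))
  have h6 : K.det = M.det ∨ K.det = -M.det := sq_eq_sq_iff_eq_or_eq_neg.1 (by rw [← h3, ← h4])
  rcases h6 with h6 | h6
  · rw [h6] at h5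
    exact smul_right_injective _ hd h5
  · rw [h6, neg_smul, ← smul_neg] at h5
    have h7 := congrArg Matrix.trace (smul_right_injective _ hd h5)
    rw [trace_neg] at h7
    linarith

/-- If the determinant vanishes, exactly one `μ i` is zero, since pairwise sums are positive, and
the adjugate is a nonzero multiple of the projection onto that axis. A cross-product matrix
commuting with it has its vector on the axis. So the columns of `diagonal μ - ε • K` lie on the
axis, and the other two rows vanish. A 2 × 2 minor kills the remaining diagonal entry of `K`. -/
theorem diagonal_eq_of_adjugate_eq {μ : Fin 3 → ℝ} (hμ : ∀ i j, i ≠ j → 0 < μ i + μ j)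
    {K : Matrix (Fin 3) (Fin 3) ℝ} (hK : Kᵀ = K) (hKt : 0 < K.trace) {ε : ℝ} (hε : ε * ε = 1)
    (h : (diagonal μ).adjugate = K.adjugate)
    (hc : ∀ i, (diagonal μ).adjugate * skewMatrix ((diagonal μ - ε • K)ᵀ i)
      = skewMatrix ((diagonal μ - ε • K)ᵀ i) * (diagonal μ).adjugate) :
    diagonal μ = K := by
  have h01 := hμ 0 1 (by decide)
  have h02 := hμ 0 2 (by decide)
  have h12 := hμ 1 2 (by decide)
  by_cases hd : (diagonal μ).det = 0
  swap
  · refine eq_of_adjugate_eq_of_det_ne_zero (by simp) ?_ hKt h hd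
    simp [Matrix.trace, Fin.sum_univ_three]
    linarith
  have hε' : ε ≠ 0 := by rintro rfl; simp at hε
  -- Both traces are positive, which rules out `ε = -1`.
  suffices hs : diagonal μ = ε • K by
    rcases mul_self_eq_one_iff.1 hε with rfl | rfl
    · simpa using hs
    · have := congrArg Matrix.trace hs
      simp [Matrix.trace, Fin.sum_univ_three] at this hKt
      linarith
  obtain ⟨a, b, c, d, e, f, rfl⟩ := exists_eq_of_transpose_eq hK
  simp only [adjugate_fin_three] at h hc
  have c0 := hc 0
  have c1 := hc 1
  have c2 := hc 2
  rw [← Matrix.ext_iff] at h c0 c1 c2 ⊢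
  simp [Fin.forall_fin_succ, skewMatrix, Matrix.mul_apply, Fin.sum_univ_three] at h c0 c1 c2 ⊢
  simp [det_diagonal, Fin.prod_univ_three] at hd
  -- Here `p` and `q` are the nonzero eigenvalues and `a` is the entry of `K` on the degenerate
  -- axis; the three cases differ by a relabelling.
  have key : ∀ p q a b c d e f : ℝ, p ≠ 0 → q ≠ 0 → p * q * (ε * b) = 0 → p * q * (ε * c) = 0 →
      p * q * (ε * e) = 0 → p * q * (p - ε * d) = 0 → p * q * (q - ε * f) = 0 →
      a * f - c * c = 0 → a = 0 ∧ b = 0 ∧ c = 0 ∧ e = 0 ∧ p = ε * d ∧ q = ε * f := by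
    intro p q a b c d e f hp hq hb hc he hd hf ha
    simp only [mul_eq_zero, hp, hq, hε', false_or, sub_eq_zero] at hb hc he hd hf
    subst hb hc he
    have hf' : f ≠ 0 := by
      rintro rfl
      simp [hq] at hf
    simp only [mul_zero, sub_zero, mul_eq_zero, hf', or_false] at ha
    exact ⟨ha, rfl, rfl, rfl, hd, hf⟩
  obtain ⟨⟨g1, g2, g3⟩, ⟨g4, g5, g6⟩, g7, g8, g9⟩ := h
  obtain ⟨⟨p1, p2⟩, ⟨p3, p4⟩, p5, p6⟩ := c0
  obtain ⟨⟨q1, q2⟩, ⟨q3, q4⟩, q5, q6⟩ := c1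
  obtain ⟨⟨r1, r2⟩, ⟨r3, r4⟩, r5, r6⟩ := c2
  rcases hd with (hd | hd) | hd
  · obtain ⟨ha, hb, hc, he, hd', hf⟩ := key (μ 1) (μ 2) a b c d e f (by linarith) (by linarith)
      (by linear_combination p2 + ε * b * μ 1 * hd) (by linear_combination p1 + ε * c * μ 2 * hd)
      (by linear_combination q1 + ε * e * μ 2 * hd)
      (by linear_combination q2 + (μ 1 - ε * d) * μ 1 * hd)
      (by linear_combination -r3 + (μ 2 - ε * f) * μ 2 * hd)
      (by linear_combination -g5 + μ 2 * hd)
    simp [ha, hb, hc, he, ← hd', ← hf, hd]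
  · obtain ⟨ha, hb, hc, he, hd', hf⟩ := key (μ 0) (μ 2) d b e a c f (by linarith) (by linarith)
      (by linear_combination q4 + ε * b * μ 0 * hd) (by linear_combination q3 + ε * e * μ 2 * hd)
      (by linear_combination p3 + ε * c * μ 2 * hd)
      (by linear_combination -p4 + (μ 0 - ε * a) * μ 0 * hd)
      (by linear_combination r3 + (μ 2 - ε * f) * μ 2 * hd)
      (by linear_combination -g1 + μ 2 * hd)
    simp [ha, hb, hc, he, ← hd', ← hf, hd]
  · obtain ⟨ha, hb, hc, he, hd', hf⟩ := key (μ 0) (μ 1) f c e a b d (by linarith) (by linarith)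
      (by linear_combination r6 + ε * c * μ 0 * hd) (by linear_combination r5 + ε * e * μ 1 * hd)
      (by linear_combination p5 + ε * b * μ 1 * hd)
      (by linear_combination p6 + (μ 0 - ε * a) * μ 0 * hd)
      (by linear_combination -q5 + (μ 1 - ε * d) * μ 1 * hd)
      (by linear_combination -g1 + μ 1 * hd)
    simp [ha, hb, hc, he, ← hd', ← hf, hd]

/-! ### The frame change attached to a map into the rotation group -/

section FrameChangeConstruction

variable {R : Type*} [CommRing R] [Algebra ℝ R]

/-- A matrix of functions `F` that is orthogonal has logarithmic derivatives that are
skew-symmetric. -/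
theorem Derivation.exists_map_eq_mul_skewMatrix (X : Fin 3 → Derivation ℝ R R)
    {F : Matrix (Fin 3) (Fin 3) R} (hF : Fᵀ * F = 1) :
    ∃ Y : Matrix (Fin 3) (Fin 3) R, ∀ i, F.map (X i) = F * skewMatrix (Yᵀ i) := by
  have hs : ∀ i, (Fᵀ * F.map (X i))ᵀ = -(Fᵀ * F.map (X i)) := fun i => by
    have := Derivation.map_matrix_mul (X i) Fᵀ F
    rw [hF, Derivation.map_matrix_one, Derivation.map_matrix_transpose] at this
    rw [transpose_mul, transpose_transpose, eq_neg_iff_add_eq_zero, ← this]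
  choose b hb using fun i => (⟨_, exists_skewMatrix_eq isUnit_two_of_algebra (hs i)⟩ :
    ∃ b : Fin 3 → R, Fᵀ * F.map (X i) = skewMatrix b)
  refine ⟨(Matrix.of b)ᵀ, fun i => ?_⟩
  change _ = F * skewMatrix (b i)
  rw [← hb, ← Matrix.mul_assoc, mul_eq_one_comm.1 hF, Matrix.one_mul]

/-- The torsion equation is the Maurer–Cartan equation for `Y`, the matrix of `F⁻¹ dF`, multiplied
by `P`. By `hP`, the matrix `L'` turns the cofactors of `P` back into `P`. -/
theorem IsFrameChange.of_map_eq_mul_skewMatrix {X : Fin 3 → Derivation ℝ R R}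
    {F Y : Matrix (Fin 3) (Fin 3) R} {L : Matrix (Fin 3) (Fin 3) R}
    {L' P : Matrix (Fin 3) (Fin 3) ℝ}
    (hX : ∀ c r, X (c + 1) (X (c + 2) r) - X (c + 2) (X (c + 1) r) = ∑ k, L k c * X k r)
    (hF : Fᵀ * F = 1) (hY : ∀ i, F.map (X i) = F * skewMatrix (Yᵀ i))
    (hP : L' * P.adjugateᵀ = P)
    (hQ : (P.map (algebraMap ℝ R) * Y)ᵀ * (P.map (algebraMap ℝ R) * Y) = 1) :
    IsFrameChange X L (L'.map (algebraMap ℝ R)) (P.map (algebraMap ℝ R) * Y) := by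
  refine ⟨hX, hQ, ?_⟩
  have hFF : ∀ i j, (F.map (X j)).map (X i) = F * (skewMatrix (Yᵀ i) * skewMatrix (Yᵀ j)
      + skewMatrix (fun k => X i (Y k j))) := by
    intro i j
    rw [hY j, Derivation.map_matrix_mul, hY i, Matrix.mul_add, Matrix.mul_assoc]
    congr 2
    exact skewMatrix_map (X i : R →+ R) _
  have hcomm : ∀ c, Yᵀ (c + 1) ⨯₃ Yᵀ (c + 2) +
      ((fun k => X (c + 1) (Y k (c + 2))) - fun k => X (c + 2) (Y k (c + 1)))
      = (Y * L)ᵀ c := by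
    intro c
    apply skewMatrix_injective
    have e : (F.map (X (c + 2))).map (X (c + 1)) - (F.map (X (c + 1))).map (X (c + 2))
        = F * skewMatrix ((Y * L)ᵀ c) := by
      have : skewMatrix ((Y * L)ᵀ c) = ∑ k, L k c • skewMatrix (Yᵀ k) := by
        simp only [Fin.sum_univ_three, ← skewMatrix_smul, ← skewMatrix_add]
        congr 1
        ext k
        simp only [transpose_apply, Matrix.mul_apply, Fin.sum_univ_three, Pi.add_apply,
          Pi.smul_apply, smul_eq_mul]
        ring
      rw [this, Matrix.mul_sum]
      simp only [Matrix.mul_smul, ← hY]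
      ext k l
      have := hX c (F k l)
      simpa [Matrix.sum_apply] using this
    rw [hFF, hFF, ← Matrix.mul_sub] at e
    have e' := congrArg (Fᵀ * ·) e
    simp only [← Matrix.mul_assoc, hF, Matrix.one_mul] at e'
    rw [skewMatrix_add, skewMatrix_crossProduct, skewMatrix_sub, ← e']
    abel
  have hcross : ∀ k c, (Yᵀ (c + 1) ⨯₃ Yᵀ (c + 2)) k = Y.adjugateᵀ k c := by
    intro k c
    rw [adjugate_fin_three]
    fin_cases k <;> fin_cases c <;> simp [cross_apply] <;> ring
  have hmat : Matrix.of (fun k c => X (c + 1) (Y k (c + 2)) - X (c + 2) (Y k (c + 1)))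
      + Y.adjugateᵀ = Y * L := by
    ext k c
    have := congrFun (hcomm c) k
    rw [Pi.add_apply, hcross] at this
    rw [Matrix.add_apply, add_comm]
    exact this
  have hadj : L'.map (algebraMap ℝ R) * (P.map (algebraMap ℝ R) * Y).adjugateᵀ
      = P.map (algebraMap ℝ R) * Y.adjugateᵀ := by
    have e : (P.map (algebraMap ℝ R)).adjugate = P.adjugate.map (algebraMap ℝ R) :=
      ((algebraMap ℝ R).map_adjugate P).symm
    rw [adjugate_mul_distrib, transpose_mul, ← Matrix.mul_assoc, e, ← Matrix.transpose_map,
      ← Matrix.map_mul, hP]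
  have hmul : Matrix.of (fun k c => X (c + 1) ((P.map (algebraMap ℝ R) * Y) k (c + 2))
      - X (c + 2) ((P.map (algebraMap ℝ R) * Y) k (c + 1)))
      = P.map (algebraMap ℝ R) *
        Matrix.of (fun k c => X (c + 1) (Y k (c + 2)) - X (c + 2) (Y k (c + 1))) := by
    ext k c
    simp only [Matrix.of_apply, Matrix.mul_apply, Fin.sum_univ_three, map_apply, map_add,
      Derivation.leibniz, Derivation.map_algebraMap, smul_eq_mul]
    ring
  intro k c
  rw [hadj, Matrix.mul_assoc, ← hmat, Matrix.mul_add, ← hmul]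
  rfl

end FrameChangeConstruction

/-! ### Left-invariant vector fields in the Cayley chart -/

namespace SO3

open scoped Manifold ContDiff

/-- The algebra of smooth functions on the chart domain. -/
def smoothFunctions : Subalgebra ℝ (E3 → ℝ) where
  carrier := {h | ContDiff ℝ ∞ h}
  mul_mem' h k := by
    simp only [Set.mem_ofPred_eq] at h k ⊢
    exact h.mul k
  add_mem' h k := by
    simp only [Set.mem_ofPred_eq] at h k ⊢
    exact h.add k
  algebraMap_mem' a := by
    simp only [Set.mem_ofPred_eq]
    exact (contDiff_const : ContDiff ℝ ∞ fun _ : E3 => a)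

theorem mem_smoothFunctions {h : E3 → ℝ} : h ∈ smoothFunctions ↔ ContDiff ℝ ∞ h := by
  change h ∈ {h : E3 → ℝ | ContDiff ℝ ∞ h} ↔ _
  simp only [Set.mem_ofPred_eq]

theorem contDiff_coe (h : smoothFunctions) : ContDiff ℝ ∞ (h : E3 → ℝ) :=
  mem_smoothFunctions.1 h.2

theorem differentiableAt_coe (h : smoothFunctions) (v : E3) :
    DifferentiableAt ℝ (h : E3 → ℝ) v :=
  (contDiff_coe h).contDiffAt.differentiableAt (by simp)

/-- The left-invariant vector field of `SO(3)` with the value `u` at the identity, in the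
Cayley chart. -/
noncomputable def leftField (u : Fin 3 → ℝ) (v : E3) : E3 :=
  !₂[u 0 + (v 1 * u 2 - v 2 * u 1) / 2 + (v 0 * u 0 + v 1 * u 1 + v 2 * u 2) * v 0 / 4,
     u 1 + (v 2 * u 0 - v 0 * u 2) / 2 + (v 0 * u 0 + v 1 * u 1 + v 2 * u 2) * v 1 / 4,
     u 2 + (v 0 * u 1 - v 1 * u 0) / 2 + (v 0 * u 0 + v 1 * u 1 + v 2 * u 2) * v 2 / 4]

theorem contDiff_leftField (u : Fin 3 → ℝ) : ContDiff ℝ ∞ (leftField u) := by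
  refine contDiff_piLp' 2 fun i => ?_
  fin_cases i <;> simp [leftField] <;> fun_prop

theorem fderiv_apply_of_forall_line {V : E3 → ℝ} {x y : E3} (hV : DifferentiableAt ℝ V x)
    {b : ℝ} (h : HasDerivAt (fun t : ℝ => V (x + t • y)) b 0) : fderiv ℝ V x y = b := by
  rw [← hV.lineDeriv_eq_fderiv]
  exact h.deriv

/-- Along a line, the components of `leftField` and the numerators and denominator in `cayleyMatrix`
are quadratic, so directional derivatives can be read off from the linear coefficients. -/
theorem hasDerivAt_quadratic (a b c : ℝ) :
    HasDerivAt (fun t : ℝ => a + t * b + t ^ 2 * c) b 0 := by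
  simpa using (((hasDerivAt_id (0 : ℝ)).mul_const b).const_add a).fun_add
    ((hasDerivAt_pow 2 (0 : ℝ)).mul_const c)

theorem fderiv_leftField (u : Fin 3 → ℝ) (x y : E3) : fderiv ℝ (leftField u) x y =
    !₂[(y 1 * u 2 - y 2 * u 1) / 2 + (y 0 * u 0 + y 1 * u 1 + y 2 * u 2) * x 0 / 4
        + (x 0 * u 0 + x 1 * u 1 + x 2 * u 2) * y 0 / 4,
      (y 2 * u 0 - y 0 * u 2) / 2 + (y 0 * u 0 + y 1 * u 1 + y 2 * u 2) * x 1 / 4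
        + (x 0 * u 0 + x 1 * u 1 + x 2 * u 2) * y 1 / 4,
      (y 0 * u 1 - y 1 * u 0) / 2 + (y 0 * u 0 + y 1 * u 1 + y 2 * u 2) * x 2 / 4
        + (x 0 * u 0 + x 1 * u 1 + x 2 * u 2) * y 2 / 4] := by
  have hd : DifferentiableAt ℝ (leftField u) x :=
    (contDiff_leftField u).contDiffAt.differentiableAt (by simp)
  ext i
  have h1 : (fderiv ℝ (leftField u) x y) i = fderiv ℝ (fun z => leftField u z i) x y := by
    have := ((EuclideanSpace.proj (𝕜 := ℝ) i).hasFDerivAt.comp x hd.hasFDerivAt).fderiv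
    exact (congrArg (fun l => l y) this).symm
  rw [h1]
  have hd' : DifferentiableAt ℝ (fun z => leftField u z i) x :=
    (EuclideanSpace.proj (𝕜 := ℝ) i).differentiableAt.comp x hd
  refine fderiv_apply_of_forall_line hd' ?_
  have key : ∀ a b c : ℝ, (∀ t : ℝ, leftField u (x + t • y) i = a + t * b + t ^ 2 * c) →
      HasDerivAt (fun t : ℝ => leftField u (x + t • y) i) b 0 := fun a b c h =>
    (hasDerivAt_quadratic a b c).congr_of_eventuallyEq (Filter.Eventually.of_forall h)
  refine key (leftField u x i) _ ((y 0 * u 0 + y 1 * u 1 + y 2 * u 2) * y i / 4) fun t => ?_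
  fin_cases i <;> simp [leftField] <;> ring

theorem lieBracket_leftField (u v : Fin 3 → ℝ) (x : E3) :
    VectorField.lieBracket ℝ (leftField u) (leftField v) x = leftField (u ⨯₃ v) x := by
  rw [VectorField.lieBracket, fderiv_leftField, fderiv_leftField]
  ext i
  fin_cases i <;> simp [leftField, cross_apply] <;> ring

theorem leftField_add (u v : Fin 3 → ℝ) (x : E3) :
    leftField (u + v) x = leftField u x + leftField v x := by
  ext i
  fin_cases i <;> simp [leftField] <;> ring

theorem leftField_smul (a : ℝ) (u : Fin 3 → ℝ) (x : E3) :
    leftField (a • u) x = a • leftField u x := by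
  ext i
  fin_cases i <;> simp [leftField] <;> ring

/-- The derivation of the algebra of smooth functions given by a left-invariant vector field. -/
noncomputable def leftDerivation (u : Fin 3 → ℝ) : Derivation ℝ smoothFunctions smoothFunctions :=
  Derivation.mk'
    { toFun := fun h => ⟨fun v => fderiv ℝ (h : E3 → ℝ) v (leftField u v),
        mem_smoothFunctions.2 (((contDiff_coe h).fderiv_right (m := ∞) (by simp)).clm_apply
          (contDiff_leftField u))⟩
      map_add' := fun h k => by
        ext v
        change fderiv ℝ ((h : E3 → ℝ) + (k : E3 → ℝ)) v _ =
          fderiv ℝ (h : E3 → ℝ) v _ + fderiv ℝ (k : E3 → ℝ) v _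
        rw [fderiv_add (differentiableAt_coe h v) (differentiableAt_coe k v)]
        rfl
      map_smul' := fun a h => by
        ext v
        change fderiv ℝ (a • (h : E3 → ℝ)) v _ = a • fderiv ℝ (h : E3 → ℝ) v _
        rw [fderiv_const_smul (differentiableAt_coe h v)]
        rfl }
    fun h k => by
      ext v
      change fderiv ℝ ((h : E3 → ℝ) * (k : E3 → ℝ)) v _ =
        (h : E3 → ℝ) v * fderiv ℝ (k : E3 → ℝ) v _ +
        (k : E3 → ℝ) v * fderiv ℝ (h : E3 → ℝ) v _
      rw [fderiv_mul (differentiableAt_coe h v) (differentiableAt_coe k v)]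
      rfl

theorem leftDerivation_apply (u : Fin 3 → ℝ) (h : smoothFunctions) (v : E3) :
    (leftDerivation u h : E3 → ℝ) v = fderiv ℝ (h : E3 → ℝ) v (leftField u v) := rfl

theorem leftDerivation_add (u v : Fin 3 → ℝ) (h : smoothFunctions) :
    leftDerivation (u + v) h = leftDerivation u h + leftDerivation v h := by
  ext x
  simp [leftDerivation_apply, leftField_add]

theorem leftDerivation_smul (a : ℝ) (u : Fin 3 → ℝ) (h : smoothFunctions) :
    leftDerivation (a • u) h = a • leftDerivation u h := by
  ext x
  simp [leftDerivation_apply, leftField_smul]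

theorem leftDerivation_commutator (u v : Fin 3 → ℝ) (h : smoothFunctions) :
    leftDerivation u (leftDerivation v h) - leftDerivation v (leftDerivation u h)
      = leftDerivation (u ⨯₃ v) h := by
  ext x
  have hh : ContDiffAt ℝ ∞ (h : E3 → ℝ) x := (contDiff_coe h).contDiffAt
  have := VectorField.fderiv_apply_lieBracket (𝕜 := ℝ) (V := leftField u) (W := leftField v) hh
    (by rw [minSmoothness_of_isRCLikeNormedField]; exact WithTop.coe_le_coe.2 le_top)
    ((contDiff_leftField v).contDiffAt.differentiableAt (by simp))
    ((contDiff_leftField u).contDiffAt.differentiableAt (by simp))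
  rw [lieBracket_leftField] at this
  exact this.symm

/-- Column `c` of `W.adjugateᵀ` is the cross product of columns `c + 1` and `c + 2` of `W`, indices
modulo 3, so `h` expands the brackets of the columns of `W` in these columns. -/
theorem leftDerivation_bracket {W L : Matrix (Fin 3) (Fin 3) ℝ} (h : W * L = W.adjugateᵀ)
    (c : Fin 3) (r : smoothFunctions) :
    leftDerivation (Wᵀ (c + 1)) (leftDerivation (Wᵀ (c + 2)) r)
      - leftDerivation (Wᵀ (c + 2)) (leftDerivation (Wᵀ (c + 1)) r)
      = ∑ k, L.map (algebraMap ℝ smoothFunctions) k c * leftDerivation (Wᵀ k) r := by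
  have e : Wᵀ (c + 1) ⨯₃ Wᵀ (c + 2) = L 0 c • Wᵀ 0 + L 1 c • Wᵀ 1 + L 2 c • Wᵀ 2 := by
    have h1 : Wᵀ (c + 1) ⨯₃ Wᵀ (c + 2) = (W * L)ᵀ c := by
      rw [h, adjugate_fin_three]
      ext k
      fin_cases k <;> fin_cases c <;> simp [cross_apply] <;> ring
    rw [h1]
    ext k
    simp only [transpose_apply, Matrix.mul_apply, Fin.sum_univ_three, Pi.add_apply, Pi.smul_apply,
      smul_eq_mul]
    ring
  rw [leftDerivation_commutator, e]
  simp only [leftDerivation_add, leftDerivation_smul, Fin.sum_univ_three, map_apply]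
  simp only [Algebra.smul_def]

theorem fderiv_cayleyMatrix_leftField (u : Fin 3 → ℝ) (v : E3) (i j : Fin 3) :
    fderiv ℝ (fun w => cayleyMatrix w i j) v (leftField u v)
      = (cayleyMatrix v * skewMatrix u) i j := by
  have hd : DifferentiableAt ℝ (fun w => cayleyMatrix w i j) v :=
    ((contDiff_pi.1 (contDiff_pi.1 contDiff_cayleyMatrix i) j).contDiffAt.differentiableAt
      (by simp))
  refine fderiv_apply_of_forall_line hd ?_
  generalize hy : leftField u v = y
  have hpos := (den_pos v).ne'
  set q0 := 1 + (v 0 ^ 2 + v 1 ^ 2 + v 2 ^ 2) / 4 with hq0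
  set q1 := (v 0 * y 0 + v 1 * y 1 + v 2 * y 2) / 2 with hq1
  have key : ∀ d p q r, (∀ t : ℝ, (hat (v + t • y) + (1 / 2 : ℝ) •
      (hat (v + t • y) * hat (v + t • y))) i j = p + t * q + t ^ 2 * r) →
      (1 : Matrix (Fin 3) (Fin 3) ℝ) i j = d →
      HasDerivAt (fun t : ℝ => cayleyMatrix (v + t • y) i j)
        ((q * q0 - p * q1) / q0 ^ 2) 0 := by
    intro d p q r hp hd
    have h1 := hasDerivAt_quadratic q0 q1 ((y 0 ^ 2 + y 1 ^ 2 + y 2 ^ 2) / 4)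
    have h2 := hasDerivAt_quadratic p q r
    have h3 := ((h1.fun_inv (by simpa using hpos)).fun_mul h2).const_add d
    have h4 : (q * q0 - p * q1) / q0 ^ 2 =
        -q1 / (q0 + 0 * q1 + 0 ^ 2 * ((y 0 ^ 2 + y 1 ^ 2 + y 2 ^ 2) / 4)) ^ 2 *
          (p + 0 * q + 0 ^ 2 * r) +
        (q0 + 0 * q1 + 0 ^ 2 * ((y 0 ^ 2 + y 1 ^ 2 + y 2 ^ 2) / 4))⁻¹ * q := by
      simp
      field_simp
      ring
    rw [h4]
    refine h3.congr_of_eventuallyEq (Filter.Eventually.of_forall fun t => ?_)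
    simp only [cayleyMatrix, Matrix.add_apply (1 : Matrix (Fin 3) (Fin 3) ℝ),
      Matrix.smul_apply _ (_ + _), hp, hd, smul_eq_mul]
    congr 3
    simp [hq0, hq1]
    ring
  have hval : ((hat y + (1 / 2 : ℝ) • (hat v * hat y + hat y * hat v)) i j * q0 -
      (hat v + (1 / 2 : ℝ) • (hat v * hat v)) i j * q1) / q0 ^ 2
      = (cayleyMatrix v * skewMatrix u) i j := by
    have e0 : y 0 = leftField u v 0 := by rw [hy]
    have e1 : y 1 = leftField u v 1 := by rw [hy]
    have e2 : y 2 = leftField u v 2 := by rw [hy]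
    simp [leftField] at e0 e1 e2
    rw [div_eq_iff (pow_ne_zero 2 hpos)]
    have hC : cayleyMatrix v = 1 + q0⁻¹ • (hat v + (1 / 2 : ℝ) • (hat v * hat v)) := rfl
    have hs : (cayleyMatrix v * skewMatrix u) i j * q0 ^ 2 = skewMatrix u i j * q0 ^ 2 +
        q0 * ((hat v + (1 / 2 : ℝ) • (hat v * hat v)) * skewMatrix u) i j := by
      rw [hC, Matrix.add_mul, Matrix.one_mul, Matrix.smul_mul, Matrix.add_apply,
        Matrix.smul_apply, smul_eq_mul]
      field_simp
    rw [hs, hq1, hq0]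
    fin_cases i <;> fin_cases j <;> simp [hat, skewMatrix] <;> rw [e0, e1, e2] <;> ring
  rw [← hval]
  refine key _ _ _ (((1 / 2 : ℝ) • (hat y * hat y)) i j) (fun t => ?_) rfl
  fin_cases i <;> fin_cases j <;> simp [hat] <;> ring

/-! ### Tangent vectors as matrices, and the Gram matrix of a left-invariant metric -/

theorem hat_injective : Function.Injective hat := by
  intro u v h
  ext i
  exact congrFun (skewMatrix_injective (R := ℝ) h) i

theorem contMDiff_cayley : ContMDiff (𝓡 3) (𝓡 3) ω cayley :=
  contMDiff_of_entries contDiff_cayleyMatrix.contMDiff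

theorem mdifferentiable_entries :
    MDifferentiable (𝓡 3) 𝓘(ℝ, Fin 3 → Fin 3 → ℝ) entries :=
  contMDiff_entries.mdifferentiable (by simp)

theorem contMDiff_mul_left' (A : SO3) : ContMDiff (𝓡 3) (𝓡 3) ω (fun B : SO3 => A * B) :=
  contMDiff_mul_left

/-- The derivative, in the space of matrices, of a map of the form `A ↦ P * A * S`. -/
theorem mfderiv_entries_of_eq_mul_mul {f : SO3 → SO3} (hf : MDifferentiable (𝓡 3) (𝓡 3) f)
    {P S : Matrix (Fin 3) (Fin 3) ℝ}
    (h : ∀ A : SO3, (f A : Matrix (Fin 3) (Fin 3) ℝ) = P * A * S) (A : SO3)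
    (U : TangentSpace (𝓡 3) A) :
    Matrix.of (mfderiv (𝓡 3) 𝓘(ℝ, Fin 3 → Fin 3 → ℝ) entries (f A) (mfderiv (𝓡 3) (𝓡 3) f A U))
      = P * Matrix.of (mfderiv (𝓡 3) 𝓘(ℝ, Fin 3 → Fin 3 → ℝ) entries A U) * S := by
  have h1 := mfderiv_comp (I := 𝓡 3) (I' := 𝓡 3) (I'' := 𝓘(ℝ, Fin 3 → Fin 3 → ℝ)) A
    (mdifferentiable_entries (f A)) (hf A)
  let T : (Fin 3 → Fin 3 → ℝ) →L[ℝ] (Fin 3 → Fin 3 → ℝ) :=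
    LinearMap.toContinuousLinearMap
      { toFun := fun N i j => (P * Matrix.of N * S) i j
        map_add' := fun N N' => by
          ext i j
          simp [Matrix.mul_apply, Fin.sum_univ_three]
          ring
        map_smul' := fun a N => by ext i j; simp [← Matrix.smul_of] }
  have h2 := mfderiv_comp (I := 𝓡 3) (I' := 𝓘(ℝ, Fin 3 → Fin 3 → ℝ))
    (I'' := 𝓘(ℝ, Fin 3 → Fin 3 → ℝ)) (g := T) A
    T.differentiableAt.mdifferentiableAt (mdifferentiable_entries A)
  have h3 : entries ∘ f = T ∘ entries := by
    funext B i j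
    exact congrFun (congrFun (h B) i) j
  rw [h3, h2, mfderiv_eq_fderiv, T.fderiv] at h1
  exact (congrArg (fun l => Matrix.of (l U)) h1).symm

/-- The derivative of the inclusion in the space of matrices commutes with left translations. -/
theorem mfderiv_entries_mul_left (A B : SO3) (U : TangentSpace (𝓡 3) B) :
    Matrix.of (mfderiv (𝓡 3) 𝓘(ℝ, Fin 3 → Fin 3 → ℝ) entries (A * B)
      (mfderiv (𝓡 3) (𝓡 3) (fun C : SO3 => A * C) B U))
      = (A : Matrix (Fin 3) (Fin 3) ℝ) *
        Matrix.of (mfderiv (𝓡 3) 𝓘(ℝ, Fin 3 → Fin 3 → ℝ) entries B U) := by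
  have h := mfderiv_entries_of_eq_mul_mul (f := fun C : SO3 => A * C) (P := A) (S := 1)
    ((contMDiff_mul_left' A).mdifferentiable (by simp)) (fun C => by simp) B U
  rwa [Matrix.mul_one] at h

/-- Needed because `A⁻¹ * A` is only propositionally `1`, whereas all tangent spaces are
definitionally `E3`. -/
theorem inner_one_congr (g : SmoothMetric) {A : SO3} (hA : A = 1) (x y : E3) :
    g.inner A x y = g.inner 1 x y := by
  subst hA
  rfl

theorem mfderiv_entries_of_eq_one {A : SO3} (hA : A = 1) (x : E3) :
    Matrix.of (mfderiv (𝓡 3) 𝓘(ℝ, Fin 3 → Fin 3 → ℝ) entries A x) = hat x := by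
  subst hA
  exact toMatrix_apply x

theorem hat_mfderiv_mul_left_inv (A : SO3) (U : TangentSpace (𝓡 3) A) :
    hat (mfderiv (𝓡 3) (𝓡 3) (fun C : SO3 => A⁻¹ * C) A U)
      = (A : Matrix (Fin 3) (Fin 3) ℝ)ᵀ *
        Matrix.of (mfderiv (𝓡 3) 𝓘(ℝ, Fin 3 → Fin 3 → ℝ) entries A U) :=
  (mfderiv_entries_of_eq_one (inv_mul_cancel A) _).symm.trans (mfderiv_entries_mul_left A⁻¹ A U)

/-- Tangent vectors of `SO(3)` at `A` are of the form `A * X` with `X` skew-symmetric. -/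
theorem exists_mfderiv_entries_eq (A : SO3) (U : TangentSpace (𝓡 3) A) :
    ∃ x : E3, Matrix.of (mfderiv (𝓡 3) 𝓘(ℝ, Fin 3 → Fin 3 → ℝ) entries A U)
      = (A : Matrix (Fin 3) (Fin 3) ℝ) * hat x := by
  refine ⟨mfderiv (𝓡 3) (𝓡 3) (fun C : SO3 => A⁻¹ * C) A U, ?_⟩
  rw [hat_mfderiv_mul_left_inv, ← Matrix.mul_assoc, mul_eq_one_comm.1 ((mem_iff _).1 A.2).1,
    Matrix.one_mul]

/-- The value of a left-invariant metric on tangent vectors `A * X` and `A * Y`, for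
skew-symmetric `X` and `Y`. -/
theorem IsLeftInvariant.inner_eq {g : SmoothMetric} (hg : IsLeftInvariant g) {A : SO3}
    {U V : TangentSpace (𝓡 3) A} {x y : E3}
    (hx : Matrix.of (mfderiv (𝓡 3) 𝓘(ℝ, Fin 3 → Fin 3 → ℝ) entries A U)
      = (A : Matrix (Fin 3) (Fin 3) ℝ) * hat x)
    (hy : Matrix.of (mfderiv (𝓡 3) 𝓘(ℝ, Fin 3 → Fin 3 → ℝ) entries A V)
      = (A : Matrix (Fin 3) (Fin 3) ℝ) * hat y) :
    g.inner A U V = g.inner 1 x y := by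
  have key : ∀ (U : TangentSpace (𝓡 3) A) (x : E3),
      Matrix.of (mfderiv (𝓡 3) 𝓘(ℝ, Fin 3 → Fin 3 → ℝ) entries A U)
        = (A : Matrix (Fin 3) (Fin 3) ℝ) * hat x →
      (mfderiv (𝓡 3) (𝓡 3) (fun C : SO3 => A⁻¹ * C) A U : E3) = x := by
    intro U x h
    apply hat_injective
    rw [hat_mfderiv_mul_left_inv, h, ← Matrix.mul_assoc, ((mem_iff _).1 A.2).1, Matrix.one_mul]
  rw [← hg A⁻¹ A U V]
  refine (inner_one_congr g (inv_mul_cancel A) _ _).trans ?_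
  rw [key U x hx, key V y hy]

/-- The matrix of the metric at the identity. -/
noncomputable def gramMatrix (g : SmoothMetric) : Matrix (Fin 3) (Fin 3) ℝ :=
  Matrix.of fun i j => g.inner 1 (EuclideanSpace.single i 1 : E3) (EuclideanSpace.single j 1 : E3)

theorem inner_one_eq (g : SmoothMetric) (x y : E3) :
    g.inner 1 x y = (x : Fin 3 → ℝ) ⬝ᵥ gramMatrix g *ᵥ (y : Fin 3 → ℝ) := by
  have e : ∀ x : E3, x = x 0 • (EuclideanSpace.single 0 1 : E3) +
      x 1 • (EuclideanSpace.single 1 1 : E3) + x 2 • (EuclideanSpace.single 2 1 : E3) := by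
    intro x
    ext i
    fin_cases i <;> simp
  have h1 : ∀ (a b c : ℝ) (p q r p' q' r' : TangentSpace (𝓡 3) (1 : SO3)) (a' b' c' : ℝ),
      g.inner 1 (a • p + b • q + c • r) (a' • p' + b' • q' + c' • r') =
      a * (a' * g.inner 1 p p' + b' * g.inner 1 p q' + c' * g.inner 1 p r') +
      b * (a' * g.inner 1 q p' + b' * g.inner 1 q q' + c' * g.inner 1 q r') +
      c * (a' * g.inner 1 r p' + b' * g.inner 1 r q' + c' * g.inner 1 r r') := by
    intros
    simp only [map_add, map_smul, _root_.add_apply, _root_.smul_apply, smul_eq_mul]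
    ring
  have h2 := h1 (x 0) (x 1) (x 2) (EuclideanSpace.single 0 1 : E3) (EuclideanSpace.single 1 1 : E3)
    (EuclideanSpace.single 2 1 : E3) (EuclideanSpace.single 0 1 : E3)
    (EuclideanSpace.single 1 1 : E3) (EuclideanSpace.single 2 1 : E3) (y 0) (y 1) (y 2)
  have h3 := congrArg₂ (fun x y : E3 => g.inner 1 x y) (e x) (e y)
  refine (h3.trans h2).trans ?_
  simp [gramMatrix, dotProduct, Matrix.mulVec, Fin.sum_univ_three]
  ring

theorem gramMatrix_transpose (g : SmoothMetric) : (gramMatrix g)ᵀ = gramMatrix g := by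
  ext i j
  exact g.symm 1 _ _

theorem gramMatrix_posDef (g : SmoothMetric) : (gramMatrix g).PosDef := by
  refine Matrix.PosDef.of_dotProduct_mulVec_pos ?_ fun x hx => ?_
  · exact gramMatrix_transpose g
  · have h := g.pos 1 (WithLp.toLp 2 x : E3) ?_
    · have h' := h.trans_eq (inner_one_eq g (WithLp.toLp 2 x) (WithLp.toLp 2 x))
      simpa using h'
    · intro h0
      apply hx
      ext i
      exact congrArg (fun z : E3 => z i) h0

/-- The standard basis of `E3` is orthonormal for `biInvariantForm`, so the metric operator has the
transpose of the Gram matrix as its matrix. -/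
theorem metricEigenvalues_eq (g : SmoothMetric) :
    metricEigenvalues g = (gramMatrix g).charpoly.roots := by
  let b : Module.Basis (Fin 3) ℝ E3 := (EuclideanSpace.basisFun (Fin 3) ℝ).toBasis
  have key : ∀ φ : E3 →ₗ[ℝ] E3,
      (∀ i j, φ (EuclideanSpace.single i 1) j = gramMatrix g i j) →
      φ.charpoly = (gramMatrix g).charpoly := by
    intro φ h
    rw [← Matrix.charpoly_transpose (gramMatrix g), ← LinearMap.charpoly_toMatrix φ b]
    congr 1
    ext j i
    rw [LinearMap.toMatrix_apply, transpose_apply, ← h]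
    simp [b]
  have h4 : (metricOperator g).charpoly = (gramMatrix g).charpoly := by
    refine key (metricOperator g) fun i j => ?_
    have h1 := metricOperator_spec g (EuclideanSpace.single i 1 : E3)
      (EuclideanSpace.single j 1 : E3)
    have h2 : ∀ u : E3, biInvariantForm u (EuclideanSpace.single j 1 : E3) = u j := by
      intro u
      have h : biInvariantForm u (EuclideanSpace.single j 1 : E3) =
          (1 / 2) * (hat u * (hat (EuclideanSpace.single j 1))ᵀ).trace :=
        congrArg₂ (fun M N : Matrix (Fin 3) (Fin 3) ℝ => (1 / 2) * (M * Nᵀ).trace)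
          (toMatrix_apply u) (toMatrix_apply _)
      refine h.trans ?_
      simp only [Matrix.trace, Matrix.diag, Matrix.mul_apply, Matrix.transpose_apply,
        Fin.sum_univ_three]
      fin_cases j <;> simp [hat] <;> ring
    exact (h1.trans (h2 _)).symm
  rw [metricEigenvalues, h4]

end SO3

/-! ### Spectral theorem and diagonalizing frames -/

section SpectralFrames

theorem Matrix.IsHermitian.exists_eq_transpose_mul_diagonal_mul {G : Matrix (Fin 3) (Fin 3) ℝ}
    (hG : G.IsHermitian) :
    ∃ U : Matrix (Fin 3) (Fin 3) ℝ, Uᵀ * U = 1 ∧ U.det = 1 ∧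
      G = Uᵀ * diagonal hG.eigenvalues * U := by
  have hU : ∃ U : Matrix (Fin 3) (Fin 3) ℝ, Uᵀ * U = 1 ∧ G = Uᵀ * diagonal hG.eigenvalues * U := by
    refine ⟨(hG.eigenvectorUnitary : Matrix (Fin 3) (Fin 3) ℝ)ᵀ, ?_, ?_⟩
    · have h := Unitary.coe_mul_star_self hG.eigenvectorUnitary
      simpa [Matrix.star_eq_conjTranspose] using h
    · conv_lhs => rw [hG.spectral_theorem, Unitary.conjStarAlgAut_apply]
      simp [Matrix.star_eq_conjTranspose]
  obtain ⟨U, h1, h2⟩ := hU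
  have hd : U.det * U.det = 1 := by
    have := congrArg Matrix.det h1
    simpa [Matrix.det_mul] using this
  rcases mul_self_eq_one_iff.1 hd with h | h
  · exact ⟨U, h1, h, h2⟩
  -- In odd dimension `-U` has the opposite determinant and defines the same conjugation.
  · exact ⟨-U, by simpa using h1, by norm_num [Matrix.det_neg, h], by simpa using h2⟩

/-- Take `P = √D * U` from `G = Uᵀ * D * U`. The columns of `P⁻¹` are orthonormal for `G`, and the
diagonal form of `P * Pᵀ` makes the structure constants diagonal in this frame. -/
theorem Matrix.PosDef.exists_frame {G : Matrix (Fin 3) (Fin 3) ℝ} (hG : G.PosDef) :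
    ∃ (P : Matrix (Fin 3) (Fin 3) ℝ) (d : Fin 3 → ℝ), (∀ i, 0 < d i) ∧ 0 < P.det ∧
      Pᵀ * P = G ∧ P * Pᵀ = diagonal d := by
  obtain ⟨U, h1, h2, h3⟩ := hG.isHermitian.exists_eq_transpose_mul_diagonal_mul
  set d := hG.isHermitian.eigenvalues
  have hd : ∀ i, 0 < d i := hG.eigenvalues_pos
  have hs : (diagonal fun i => √(d i)) * (diagonal fun i => √(d i)) = diagonal d := by
    rw [diagonal_mul_diagonal]
    congr 1
    ext i
    exact Real.mul_self_sqrt (hd i).le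
  refine ⟨(diagonal fun i => √(d i)) * U, d, hd, ?_, ?_, ?_⟩
  · rw [det_mul, h2, det_diagonal, mul_one]
    exact Finset.prod_pos fun i _ => Real.sqrt_pos.2 (hd i)
  · rw [h3, transpose_mul, diagonal_transpose, ← hs]
    simp only [Matrix.mul_assoc]
  · rw [transpose_mul, diagonal_transpose, Matrix.mul_assoc, ← Matrix.mul_assoc U,
      mul_eq_one_comm.1 h1, Matrix.one_mul, hs]

theorem Matrix.IsHermitian.exists_conj_eq {G G' : Matrix (Fin 3) (Fin 3) ℝ} (hG : G.IsHermitian)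
    (hG' : G'.IsHermitian) (h : G.charpoly.roots = G'.charpoly.roots) :
    ∃ C : Matrix (Fin 3) (Fin 3) ℝ, Cᵀ * C = 1 ∧ C.det = 1 ∧ Cᵀ * G' * C = G := by
  have hev : hG.eigenvalues = hG'.eigenvalues := by
    -- The family `eigenvalues₀` is sorted, so equal multisets of roots give equal families, with no
    -- permutation.
    suffices hG.eigenvalues₀ = hG'.eigenvalues₀ by
      unfold IsHermitian.eigenvalues
      rw [this]
    rw [← List.ofFn_inj, ← sort_roots_charpoly_eq_eigenvalues₀, h,
      sort_roots_charpoly_eq_eigenvalues₀]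
  obtain ⟨U, h1, h2, h3⟩ := hG.exists_eq_transpose_mul_diagonal_mul
  obtain ⟨V, k1, k2, k3⟩ := hG'.exists_eq_transpose_mul_diagonal_mul
  have k1' := mul_eq_one_comm.1 k1
  refine ⟨Vᵀ * U, ?_, ?_, ?_⟩
  · rw [transpose_mul, transpose_transpose, Matrix.mul_assoc, ← Matrix.mul_assoc V, k1',
      Matrix.one_mul, h1]
  · rw [det_mul, det_transpose, h2, k2, mul_one]
  · rw [← hev] at k3
    generalize hG.eigenvalues = d at h3 k3
    rw [h3, k3, transpose_mul, transpose_transpose]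
    calc Uᵀ * V * (Vᵀ * diagonal d * V) * (Vᵀ * U)
        = Uᵀ * (V * Vᵀ) * diagonal d * (V * Vᵀ) * U := by simp only [Matrix.mul_assoc]
      _ = _ := by rw [k1', Matrix.mul_one, Matrix.mul_one]

/-- This is the rule that `A v × A w` is the cofactor matrix of `A` applied to `v × w`. -/
theorem skewMatrix_mulVec_mul (A : Matrix (Fin 3) (Fin 3) ℝ) (v : Fin 3 → ℝ) :
    skewMatrix (A *ᵥ v) * A = A.adjugateᵀ * skewMatrix v := by
  rw [adjugate_fin_three]
  ext i j
  fin_cases i <;> fin_cases j <;>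
    simp [skewMatrix, Matrix.mul_apply, Fin.sum_univ_three, Matrix.mulVec, dotProduct] <;> ring

end SpectralFrames

/-! ### Equal eigenvalues: conjugation by a rotation is an isometry -/

namespace SO3

open scoped Manifold ContDiff

theorem hat_mulVec (C : SO3) (x : E3) :
    hat (WithLp.toLp 2 ((C : Matrix (Fin 3) (Fin 3) ℝ) *ᵥ (x : Fin 3 → ℝ)))
      = C * hat x * (C : Matrix (Fin 3) (Fin 3) ℝ)ᵀ := by
  obtain ⟨h1, h2⟩ := (mem_iff _).1 C.2
  have h := skewMatrix_mulVec_mul (C : Matrix (Fin 3) (Fin 3) ℝ) (x : Fin 3 → ℝ)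
  rw [adjugate_of_transpose_mul_self h1, h2, one_smul, transpose_transpose] at h
  have h' := congrArg (· * (C : Matrix (Fin 3) (Fin 3) ℝ)ᵀ) h
  simp only [Matrix.mul_assoc, mul_eq_one_comm.1 h1, Matrix.mul_one] at h'
  rw [Matrix.mul_assoc]
  exact h'

/-- Conjugation by a rotation, as a diffeomorphism. -/
noncomputable def conjDiffeomorph (C : SO3) : SO3 ≃ₘ^∞⟮𝓡 3, 𝓡 3⟯ SO3 where
  toEquiv := (MulAut.conj C).toEquiv
  contMDiff_toFun := by
    have h : ContMDiff (𝓡 3) (𝓡 3) ω (fun A : SO3 => C * A * C⁻¹) :=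
      (contMDiff_mul_right (a := C⁻¹)).comp (contMDiff_mul_left (a := C))
    exact h.of_le le_top
  contMDiff_invFun := by
    have h : ContMDiff (𝓡 3) (𝓡 3) ω (fun A : SO3 => C⁻¹ * A * C) :=
      (contMDiff_mul_right (a := C)).comp (contMDiff_mul_left (a := C⁻¹))
    exact h.of_le le_top

theorem isIsometric_of_metricEigenvalues_eq {g₁ g₂ : SmoothMetric} (h₁ : IsLeftInvariant g₁)
    (h₂ : IsLeftInvariant g₂) (h : metricEigenvalues g₁ = metricEigenvalues g₂) :
    IsIsometric g₁ g₂ := by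
  rw [metricEigenvalues_eq, metricEigenvalues_eq] at h
  obtain ⟨C₀, hC1, hC2, hC3⟩ := (gramMatrix_posDef g₁).isHermitian.exists_conj_eq
    (gramMatrix_posDef g₂).isHermitian h
  let C : SO3 := ⟨C₀, (mem_iff _).2 ⟨hC1, hC2⟩⟩
  have hf : MDifferentiable (𝓡 3) (𝓡 3) (conjDiffeomorph C) :=
    (conjDiffeomorph C).contMDiff.mdifferentiable (by simp)
  refine ⟨conjDiffeomorph C, fun A U V => ?_⟩
  have hd : ∀ (U : TangentSpace (𝓡 3) A) (x : E3),
      Matrix.of (mfderiv (𝓡 3) 𝓘(ℝ, Fin 3 → Fin 3 → ℝ) entries A U)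
        = (A : Matrix (Fin 3) (Fin 3) ℝ) * hat x →
      Matrix.of (mfderiv (𝓡 3) 𝓘(ℝ, Fin 3 → Fin 3 → ℝ) entries (conjDiffeomorph C A)
        (mfderiv (𝓡 3) (𝓡 3) (conjDiffeomorph C) A U))
        = (conjDiffeomorph C A : SO3) * hat (WithLp.toLp 2 (C₀ *ᵥ (x : Fin 3 → ℝ))) := by
    intro U x hx
    rw [mfderiv_entries_of_eq_mul_mul (P := C₀) (S := C₀ᵀ) hf (fun B => rfl) A U, hx]
    have e : ((conjDiffeomorph C A : SO3) : Matrix (Fin 3) (Fin 3) ℝ) = C₀ * A * C₀ᵀ := rfl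
    have e' : hat (WithLp.toLp 2 (C₀ *ᵥ (x : Fin 3 → ℝ))) = C₀ * hat x * C₀ᵀ := hat_mulVec C x
    rw [e, e']
    calc C₀ * (A * hat x) * C₀ᵀ = C₀ * A * 1 * hat x * C₀ᵀ := by
          simp only [Matrix.mul_assoc, Matrix.one_mul]
      _ = _ := by rw [← hC1]; simp only [Matrix.mul_assoc]
  obtain ⟨x, hx⟩ := exists_mfderiv_entries_eq A U
  obtain ⟨y, hy⟩ := exists_mfderiv_entries_eq A V
  rw [h₂.inner_eq (hd U x hx) (hd V y hy), h₁.inner_eq hx hy, inner_one_eq, inner_one_eq, ← hC3]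
  rw [← Matrix.mulVec_mulVec, ← Matrix.mulVec_mulVec, Matrix.dotProduct_mulVec x.ofLp,
    Matrix.vecMul_transpose]

/-! ### Isometries preserve the eigenvalues -/

theorem exists_matrix_smoothFunctions {f : SO3 → SO3} (hf : ContMDiff (𝓡 3) (𝓡 3) ∞ f) :
    ∃ F : Matrix (Fin 3) (Fin 3) smoothFunctions, Fᵀ * F = 1 ∧
      ∀ i j w, (F i j : E3 → ℝ) w = (f (cayley w) : Matrix (Fin 3) (Fin 3) ℝ) i j := by
  have hs : ContDiff ℝ ∞ (fun w i j => entries (f (cayley w)) i j) := by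
    have h := (contMDiff_entries.of_le (le_top : ∞ ≤ ω)).comp
      (hf.comp (contMDiff_cayley.of_le (le_top : ∞ ≤ ω)))
    exact contMDiff_iff_contDiff.1 h
  let F : Matrix (Fin 3) (Fin 3) smoothFunctions := fun i j =>
    ⟨fun w => entries (f (cayley w)) i j,
      mem_smoothFunctions.2 (contDiff_pi.1 (contDiff_pi.1 hs i) j)⟩
  refine ⟨F, ?_, fun i j w => rfl⟩
  ext i j w
  have h := congrFun (congrFun ((mem_iff _).1 (f (cayley w)).2).1 i) j
  simp only [Matrix.mul_apply, Fin.sum_univ_three, transpose_apply] at h ⊢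
  refine Eq.trans h ?_
  by_cases hij : i = j
  · subst hij
    rw [Matrix.one_apply_eq, Matrix.one_apply_eq]
    rfl
  · rw [Matrix.one_apply_ne hij, Matrix.one_apply_ne hij]
    rfl

/-- The derivative of `f ∘ cayley` along a left-invariant field. -/
theorem mfderiv_entries_comp_cayley {f : SO3 → SO3} (hf : ContMDiff (𝓡 3) (𝓡 3) ∞ f)
    (u : Fin 3 → ℝ) (w : E3) (i j : Fin 3) :
    mfderiv (𝓡 3) 𝓘(ℝ, Fin 3 → Fin 3 → ℝ) entries (f (cayley w))
      (mfderiv (𝓡 3) (𝓡 3) f (cayley w) (mfderiv (𝓡 3) (𝓡 3) cayley w (leftField u w))) i j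
      = fderiv ℝ (fun w => (f (cayley w) : Matrix (Fin 3) (Fin 3) ℝ) i j) w (leftField u w) := by
  have hf' := hf.mdifferentiable (by simp)
  have hc := contMDiff_cayley.mdifferentiable (by simp)
  have h1 := mfderiv_comp (I := 𝓡 3) (I' := 𝓡 3) (I'' := 𝓡 3) w (hf' (cayley w)) (hc w)
  have h2 := mfderiv_comp (I := 𝓡 3) (I' := 𝓡 3) (I'' := 𝓘(ℝ, Fin 3 → Fin 3 → ℝ)) w
    (mdifferentiable_entries (f (cayley w))) ((hf' (cayley w)).comp w (hc w))
  have hs : DifferentiableAt ℝ (entries ∘ (f ∘ cayley)) w := by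
    have h := (contMDiff_entries.of_le (le_top : ∞ ≤ ω)).comp
      (hf.comp (contMDiff_cayley.of_le (le_top : ∞ ≤ ω)))
    exact (contMDiff_iff_contDiff.1 h).contDiffAt.differentiableAt (by simp)
  have h3 : mfderiv (𝓡 3) 𝓘(ℝ, Fin 3 → Fin 3 → ℝ) (entries ∘ (f ∘ cayley)) w
      = fderiv ℝ (entries ∘ (f ∘ cayley)) w := mfderiv_eq_fderiv
  have h4 : ∀ y : E3, fderiv ℝ (entries ∘ (f ∘ cayley)) w y i j
      = fderiv ℝ (fun w => entries (f (cayley w)) i j) w y := by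
    intro y
    have h5 := hasFDerivAt_pi'.1 (hasFDerivAt_pi'.1 hs.hasFDerivAt i) j
    exact (congrArg (fun l => l y) h5.fderiv).symm
  refine Eq.trans ?_ (h4 (leftField u w))
  rw [← h3, h2, h1]
  rfl

theorem inner_eq_of_isometry {g₁ g₂ : SmoothMetric} (h₁ : IsLeftInvariant g₁)
    (h₂ : IsLeftInvariant g₂) {f : SO3 → SO3} (hf : ContMDiff (𝓡 3) (𝓡 3) ∞ f)
    (hiso : ∀ (A : SO3) (u v : TangentSpace (𝓡 3) A), g₂.inner (f A)
      (mfderiv (𝓡 3) (𝓡 3) f A u) (mfderiv (𝓡 3) (𝓡 3) f A v) = g₁.inner A u v)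
    {w : E3} {u v x y : Fin 3 → ℝ}
    (hx : ∀ i j, fderiv ℝ (fun w => (f (cayley w) : Matrix (Fin 3) (Fin 3) ℝ) i j) w
      (leftField u w) = ((f (cayley w) : Matrix (Fin 3) (Fin 3) ℝ) * skewMatrix x) i j)
    (hy : ∀ i j, fderiv ℝ (fun w => (f (cayley w) : Matrix (Fin 3) (Fin 3) ℝ) i j) w
      (leftField v w) = ((f (cayley w) : Matrix (Fin 3) (Fin 3) ℝ) * skewMatrix y) i j) :
    x ⬝ᵥ gramMatrix g₂ *ᵥ y = u ⬝ᵥ gramMatrix g₁ *ᵥ v := by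
  have hid : ∀ u : Fin 3 → ℝ, Matrix.of (mfderiv (𝓡 3) 𝓘(ℝ, Fin 3 → Fin 3 → ℝ) entries (cayley w)
      (mfderiv (𝓡 3) (𝓡 3) cayley w (leftField u w)))
      = (cayley w : Matrix (Fin 3) (Fin 3) ℝ) * hat (WithLp.toLp 2 u) := by
    intro u
    ext i j
    -- The case of the identity map identifies the tangent vector itself.
    have h := mfderiv_entries_comp_cayley (f := id) contMDiff_id u w i j
    rw [mfderiv_id] at h
    exact h.trans (fderiv_cayleyMatrix_leftField u w i j)
  have hx' : Matrix.of (mfderiv (𝓡 3) 𝓘(ℝ, Fin 3 → Fin 3 → ℝ) entries (f (cayley w))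
      (mfderiv (𝓡 3) (𝓡 3) f (cayley w) (mfderiv (𝓡 3) (𝓡 3) cayley w (leftField u w))))
      = (f (cayley w) : Matrix (Fin 3) (Fin 3) ℝ) * hat (WithLp.toLp 2 x) := by
    ext i j
    exact (mfderiv_entries_comp_cayley hf u w i j).trans (hx i j)
  have hy' : Matrix.of (mfderiv (𝓡 3) 𝓘(ℝ, Fin 3 → Fin 3 → ℝ) entries (f (cayley w))
      (mfderiv (𝓡 3) (𝓡 3) f (cayley w) (mfderiv (𝓡 3) (𝓡 3) cayley w (leftField v w))))
      = (f (cayley w) : Matrix (Fin 3) (Fin 3) ℝ) * hat (WithLp.toLp 2 y) := by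
    ext i j
    exact (mfderiv_entries_comp_cayley hf v w i j).trans (hy i j)
  have h := hiso (cayley w) (mfderiv (𝓡 3) (𝓡 3) cayley w (leftField u w))
    (mfderiv (𝓡 3) (𝓡 3) cayley w (leftField v w))
  rw [h₂.inner_eq hx' hy', h₁.inner_eq (hid u) (hid v), inner_one_eq, inner_one_eq] at h
  exact h

/-- The structure constants in an orthonormal frame. -/
noncomputable def structureMatrix (P : Matrix (Fin 3) (Fin 3) ℝ) : Matrix (Fin 3) (Fin 3) ℝ :=
  P.det⁻¹ • (P * Pᵀ)

/-- The coefficients of the Levi-Civita connection in an orthonormal frame. -/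
noncomputable def connectionMatrix (P : Matrix (Fin 3) (Fin 3) ℝ) : Matrix (Fin 3) (Fin 3) ℝ :=
  ((structureMatrix P).trace / 2) • 1 - structureMatrix P

theorem trace_connectionMatrix (P : Matrix (Fin 3) (Fin 3) ℝ) :
    (connectionMatrix P).trace = (structureMatrix P).trace / 2 := by
  simp [connectionMatrix]
  ring

theorem structureMatrix_eq (P : Matrix (Fin 3) (Fin 3) ℝ) :
    (connectionMatrix P).trace • 1 - connectionMatrix P = structureMatrix P := by
  rw [trace_connectionMatrix, connectionMatrix, sub_sub_cancel]

theorem connectionMatrix_transpose (P : Matrix (Fin 3) (Fin 3) ℝ) :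
    (connectionMatrix P)ᵀ = connectionMatrix P := by
  simp [connectionMatrix, structureMatrix]

theorem structureMatrix_mul_adjugate {P : Matrix (Fin 3) (Fin 3) ℝ} (hP : P.det ≠ 0) :
    structureMatrix P * P.adjugateᵀ = P := by
  rw [structureMatrix, Matrix.smul_mul, Matrix.mul_assoc, ← transpose_mul, adjugate_mul]
  simp [smul_smul, hP]

theorem inv_mul_structureMatrix {P : Matrix (Fin 3) (Fin 3) ℝ} (hP : P.det ≠ 0) :
    P⁻¹ * structureMatrix P = (P⁻¹).adjugateᵀ := by
  have hu : IsUnit P.det := hP.isUnit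
  have h1 : P⁻¹ * P = 1 := nonsing_inv_mul P hu
  have h2 : (P⁻¹).adjugate = P.det⁻¹ • P := by
    have h3 : (P⁻¹).adjugate * (P⁻¹ * P) = P.det⁻¹ • P := by
      rw [← Matrix.mul_assoc, adjugate_mul, det_nonsing_inv, Ring.inverse_eq_inv',
        Matrix.smul_mul, Matrix.one_mul]
    rwa [h1, Matrix.mul_one] at h3
  rw [structureMatrix, Matrix.mul_smul, ← Matrix.mul_assoc, h1, Matrix.one_mul, h2, transpose_smul]

/-- The trace turns conjugate connection matrices into conjugate structure matrices. Since `det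
(structureMatrix P)` is `(det P)⁻¹`, the scale `det P` is determined, hence `P * Pᵀ` up to
conjugation. -/
theorem charpoly_eq_of_connectionMatrix_eq {P P' q : Matrix (Fin 3) (Fin 3) ℝ} (hP : 0 < P.det)
    (hP' : 0 < P'.det) (hq : qᵀ * q = 1)
    (h : connectionMatrix P = qᵀ * connectionMatrix P' * q) :
    (Pᵀ * P).charpoly = (P'ᵀ * P').charpoly := by
  have hq' := mul_eq_one_comm.1 hq
  have ht : (connectionMatrix P).trace = (connectionMatrix P').trace := by
    rw [h, Matrix.trace_mul_comm, ← Matrix.mul_assoc, hq', Matrix.one_mul]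
  have hL : structureMatrix P = qᵀ * structureMatrix P' * q := by
    rw [← structureMatrix_eq, ← structureMatrix_eq P', ht, h]
    simp [Matrix.mul_sub, Matrix.sub_mul, hq]
  have hdet : ∀ P : Matrix (Fin 3) (Fin 3) ℝ, 0 < P.det →
      (structureMatrix P).det = P.det⁻¹ := fun P hP => by
    rw [structureMatrix, det_smul, det_mul, det_transpose, Fintype.card_fin]
    field_simp
  have hd : P.det = P'.det := by
    have h1 := congrArg Matrix.det hL
    rw [det_mul_right_comm, hq, Matrix.one_mul, hdet P hP, hdet P' hP'] at h1
    exact inv_injective h1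
  have hPP : P * Pᵀ = qᵀ * (P' * P'ᵀ) * q := by
    have h1 : ∀ P : Matrix (Fin 3) (Fin 3) ℝ, 0 < P.det → P * Pᵀ = P.det • structureMatrix P :=
      fun P hP => by rw [structureMatrix, smul_smul, mul_inv_cancel₀ hP.ne', one_smul]
    rw [h1 P hP, h1 P' hP', hL, hd, Matrix.mul_smul, Matrix.smul_mul]
  rw [charpoly_mul_comm, charpoly_mul_comm P'ᵀ, hPP, charpoly_mul_comm, ← Matrix.mul_assoc, hq',
    Matrix.one_mul]

theorem gramMatrix_charpoly_eq_of_isometry {g₁ g₂ : SmoothMetric} (h₁ : IsLeftInvariant g₁)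
    (h₂ : IsLeftInvariant g₂) {f : SO3 → SO3} (hf : ContMDiff (𝓡 3) (𝓡 3) ∞ f)
    (hiso : ∀ (A : SO3) (u v : TangentSpace (𝓡 3) A), g₂.inner (f A)
      (mfderiv (𝓡 3) (𝓡 3) f A u) (mfderiv (𝓡 3) (𝓡 3) f A v) = g₁.inner A u v) :
    (gramMatrix g₁).charpoly = (gramMatrix g₂).charpoly := by
  obtain ⟨P, d, hd, hPd, hPG, hPD⟩ := (gramMatrix_posDef g₁).exists_frame
  obtain ⟨P', d', hd', hPd', hPG', hPD'⟩ := (gramMatrix_posDef g₂).exists_frame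
  obtain ⟨F, hF, hFf⟩ := exists_matrix_smoothFunctions hf
  let X : Fin 3 → Derivation ℝ smoothFunctions smoothFunctions :=
    fun i => leftDerivation ((P⁻¹)ᵀ i)
  obtain ⟨Y, hY⟩ := Derivation.exists_map_eq_mul_skewMatrix X hF
  have hYw : ∀ w k i j, fderiv ℝ (fun w => (f (cayley w) : Matrix (Fin 3) (Fin 3) ℝ) i j) w
      (leftField ((P⁻¹)ᵀ k) w) = ((f (cayley w) : Matrix (Fin 3) (Fin 3) ℝ) *
        skewMatrix (fun l => (Y l k : E3 → ℝ) w)) i j := by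
    intro w k i j
    have h := congrArg (fun r : smoothFunctions => (r : E3 → ℝ) w) (congrFun (congrFun (hY k) i) j)
    have e : (F i j : E3 → ℝ) = fun w => (f (cayley w) : Matrix (Fin 3) (Fin 3) ℝ) i j :=
      funext fun w => hFf i j w
    have h' : ((F.map (X k)) i j : E3 → ℝ) w = fderiv ℝ (F i j : E3 → ℝ) w
      (leftField ((P⁻¹)ᵀ k) w) := rfl
    rw [e] at h'
    refine h'.symm.trans (h.trans ?_)
    have hS : ∀ l, ((skewMatrix (Yᵀ k) l j : smoothFunctions) : E3 → ℝ) w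
        = skewMatrix (fun l => (Y l k : E3 → ℝ) w) l j := by
      intro l
      fin_cases l <;> fin_cases j <;> simp [skewMatrix]
    simp only [Matrix.mul_apply, Fin.sum_univ_three, ← hS, ← hFf]
    rfl
  have hu : IsUnit P.det := hPd.ne'.isUnit
  -- The isometry hypothesis enters here: `f` carries an orthonormal frame to an orthonormal frame.
  have hQ : (P'.map (algebraMap ℝ smoothFunctions) * Y)ᵀ *
      (P'.map (algebraMap ℝ smoothFunctions) * Y) = 1 := by
    ext i j w
    have h := inner_eq_of_isometry h₁ h₂ hf hiso (hYw w i) (hYw w j)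
    have e1 : (P⁻¹)ᵀ i ⬝ᵥ gramMatrix g₁ *ᵥ (P⁻¹)ᵀ j = (1 : Matrix (Fin 3) (Fin 3) ℝ) i j := by
      have e2 : (P⁻¹)ᵀ * gramMatrix g₁ * P⁻¹ = 1 := by
        rw [← hPG, ← Matrix.mul_assoc, ← transpose_mul, Matrix.mul_assoc, mul_nonsing_inv P hu]
        simp
      rw [← e2, Matrix.mul_assoc]
      rfl
    rw [e1, ← hPG'] at h
    have e3 : (((P'.map (algebraMap ℝ smoothFunctions) * Y)ᵀ *
        (P'.map (algebraMap ℝ smoothFunctions) * Y)) i j : E3 → ℝ) w =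
        (fun l => (Y l i : E3 → ℝ) w) ⬝ᵥ (P'ᵀ * P') *ᵥ (fun l => (Y l j : E3 → ℝ) w) := by
      rw [← Matrix.mulVec_mulVec, Matrix.dotProduct_mulVec, Matrix.vecMul_transpose]
      simp only [Matrix.mul_apply, Fin.sum_univ_three, transpose_apply, map_apply, dotProduct,
        Matrix.mulVec]
      rfl
    rw [e3, h]
    by_cases hij : i = j
    · subst hij
      rw [Matrix.one_apply_eq, Matrix.one_apply_eq]
      rfl
    · rw [Matrix.one_apply_ne hij, Matrix.one_apply_ne hij]
      rfl
  have hchange : IsFrameChange X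
      ((structureMatrix P).map (algebraMap ℝ smoothFunctions))
      ((structureMatrix P').map (algebraMap ℝ smoothFunctions))
      (P'.map (algebraMap ℝ smoothFunctions) * Y) :=
    IsFrameChange.of_map_eq_mul_skewMatrix
      (leftDerivation_bracket (inv_mul_structureMatrix hPd.ne')) hF hY
      (structureMatrix_mul_adjugate hPd'.ne') hQ
  rw [← structureMatrix_eq P, ← structureMatrix_eq P'] at hchange
  -- Evaluation at the identity; any other point of the chart would serve.
  let φ : smoothFunctions →ₐ[ℝ] ℝ := (Pi.evalAlgHom ℝ (fun _ : E3 => ℝ) 0).comp smoothFunctions.val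
  obtain ⟨hq, hadj, hcomm⟩ := hchange.eval (connectionMatrix_transpose P)
    (connectionMatrix_transpose P') φ
  generalize (P'.map (algebraMap ℝ smoothFunctions) * Y).map φ = q at hq hadj hcomm
  have htr : ∀ (P : Matrix (Fin 3) (Fin 3) ℝ) (d : Fin 3 → ℝ), (∀ i, 0 < d i) → 0 < P.det →
      P * Pᵀ = diagonal d → 0 < (connectionMatrix P).trace := by
    intro P d hd hP h
    rw [trace_connectionMatrix, structureMatrix, h, trace_smul, trace_diagonal]
    have := Finset.sum_pos (fun i _ => hd i) (Finset.univ_nonempty (α := Fin 3))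
    positivity
  have hdet : q.det * q.det = 1 := by
    have := congrArg Matrix.det hq
    simpa [Matrix.det_mul] using this
  have hM : connectionMatrix P
      = diagonal fun i => P.det⁻¹ * ((d 0 + d 1 + d 2) / 2 - d i) := by
    rw [connectionMatrix, structureMatrix, hPD, trace_smul, trace_diagonal, Fin.sum_univ_three]
    ext i j
    by_cases hij : i = j
    · subst hij
      simp
      ring
    · simp [hij]
  rw [← hPG, ← hPG']
  refine charpoly_eq_of_connectionMatrix_eq hPd hPd' hq ?_
  have hK : (qᵀ * connectionMatrix P' * q)ᵀ = qᵀ * connectionMatrix P' * q := by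
    simp [connectionMatrix_transpose, Matrix.mul_assoc]
  have hKt : 0 < (qᵀ * connectionMatrix P' * q).trace := by
    rw [Matrix.trace_mul_comm, ← Matrix.mul_assoc, mul_eq_one_comm.1 hq, Matrix.one_mul]
    exact htr P' d' hd' hPd' hPD'
  rw [hM] at hadj hcomm ⊢
  -- The sum of two diagonal entries of the connection matrix is `d k / det P`, with `k` the third
  -- index.
  refine diagonal_eq_of_adjugate_eq ?_ hK hKt hdet hadj hcomm
  intro i j hij
  rw [← mul_add]
  refine mul_pos (inv_pos.2 hPd) ?_
  have h0 := hd 0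
  have h1 := hd 1
  have h2 := hd 2
  fin_cases i <;> fin_cases j <;> simp at hij ⊢ <;> linarith

end SO3

theorem proposition3p2 (g₁ g₂ : SO3.SmoothMetric) (h₁ : SO3.IsLeftInvariant g₁)
    (h₂ : SO3.IsLeftInvariant g₂) :
    SO3.IsIsometric g₁ g₂ ↔ SO3.metricEigenvalues g₁ = SO3.metricEigenvalues g₂ := by
  refine ⟨?_, SO3.isIsometric_of_metricEigenvalues_eq h₁ h₂⟩
  rintro ⟨f, hf⟩
  rw [SO3.metricEigenvalues_eq, SO3.metricEigenvalues_eq,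
    SO3.gramMatrix_charpoly_eq_of_isometry h₁ h₂ f.contMDiff hf]
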